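/- **Model.** Let $\theta_1,\theta_2$ be constants with $0<2\theta_2\le 2$ and $\theta_1\ge 2$. For even $n$ let $\sigma:[n]\to\{1,2\}$ split $[n]$ into two clusters of size $n/2$. In the geometric block model $\mathrm{GBM}(n,\sigma,\theta_1,\theta_2)$ the nodes have independent features $X_u\sim\mathrm{Unif}[0,1]$, and with $d_{uv}=\min(|X_u-X_v|,1-|X_u-X_v|)$ two distinct nodes $u,v$ are adjacent if and only if $d_{uv}\le\theta_1\frac{\log n}{n}$ (when $\sigma(u)=\sigma(v)$), respectively $d_{uv}\le\theta_2\frac{\log n}{n}$ (when $\sigma(u)\ne\sigma(v)$). **Algorithm (motif counting with $S^2$), threshold $E_T$.** Phase 1: from the observed graph $G$ remove every edge $(u,v)$ that is covered by at most $nE_T$ triangles of $G$; call the result $G_r$. Phase 2: run $S^2$ on $G_r$, i.e. repeat the following until the current graph has exactly two connected components (or all nodes are queried), and return its connected components. Query the label of a node, then remove all edges between queried nodes with different labels. If some path of the current graph joins two queried nodes with different labels, take a shortest one among all such paths and query its midpoint (ties broken arbitrarily); otherwise query a uniformly random unqueried node. **Theorem.** Put $$t_1=\inf\Big\{t\ge0:(2\theta_2+t)\log\frac{2\theta_2+t}{2\theta_2}-t>1\Big\},$$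 $$\eta=\inf\Big\{t\ge0:(2\theta_1-2-t)\log\frac{2\theta_1-2-t}{2\theta_1-2}+t>2\Big\}$$ (for $\theta_1=2$ read $\eta=2$), and $$\tau=\tfrac12(2\theta_1-2-\eta),\qquad \gamma=\tau-2\theta_2,\qquad \epsilon=\tau\log\frac{\tau}{2\theta_2}-(\tau-2\theta_2),$$ and run the algorithm with $E_T=\tau\,\frac{\log n}{n}$. 1. If $\gamma>t_1$, then with probability $1-o(1)$ the connected components of $G_r$ after Phase 1 are exactly the two clusters, so that the algorithm recovers the clusters (up to a permutation of the labels) with zero queries. 2. If $\gamma>0$ (in particular if $t_1>\gamma>0$), then with probability $1-o(1)$ the algorithm, after Phase 2, recovers the clusters exactly (up to a permutation of the labels) with at most $O\big(n^{1-\epsilon}(\log n)^3+\log n\big)$ queries. The constant depends only on $\theta_1,\theta_2$. Here $n\to\infty$ along the even integers, the assignments $\sigma=\sigma_n$ are arbitrary, and the probability is over the features and the random choices of the algorithm. -/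

import Mathlib

open MeasureTheory Filter Topology

noncomputable section

namespace GBM

/-! ### The geometric block model on the circle -/

/-- Distance on the circle of unit length, for `x, y ∈ [0, 1]`. -/
def circDist (x y : ℝ) : ℝ := min |x - y| (1 - |x - y|)

theorem circDist_comm (x y : ℝ) : circDist x y = circDist y x := by
  unfold circDist
  rw [abs_sub_comm]

/-- The two clusters of a label assignment have the same size. -/
def Balanced {n : ℕ} (σ : Fin n → Bool) : Prop :=
  {i | σ i = true}.ncard = {i | σ i = false}.ncard

/-- The graph of `GBM(n, σ, θ₁, θ₂)` for given latent features `X`: distinct nodes are joined when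
their circular distance is at most `θ₁ log n / n` (same cluster), resp. `θ₂ log n / n`
(different clusters). -/
def graph {n : ℕ} (θ₁ θ₂ : ℝ) (σ : Fin n → Bool) (X : Fin n → ℝ) : SimpleGraph (Fin n) where
  Adj u v := u ≠ v ∧
    circDist (X u) (X v) ≤ (if σ u = σ v then θ₁ else θ₂) * (Real.log n / n)
  symm := ⟨fun u v h => by
    refine ⟨h.1.symm, ?_⟩
    have h2 := h.2
    rw [circDist_comm] at h2
    simpa only [eq_comm] using h2⟩
  loopless := ⟨fun _ h => h.1 rfl⟩

/-- The law of the latent features: `n` independent uniform variables on `[0, 1]`. -/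
def featureLaw (n : ℕ) : Measure (Fin n → ℝ) :=
  Measure.pi fun _ => (volume : Measure ℝ).restrict (Set.Icc 0 1)

instance (n : ℕ) : IsProbabilityMeasure (featureLaw n) := by
  have : IsProbabilityMeasure ((volume : Measure ℝ).restrict (Set.Icc 0 1)) := ⟨by simp⟩
  unfold featureLaw
  infer_instance

/-! ### Phase 1: removing the edges covered by few triangles -/

section Algorithm

variable {V : Type*}

/-- The number of triangles of `G` that cover the pair `u, v`. -/
def triangleCount (G : SimpleGraph V) (u v : V) : ℕ := {z | G.Adj u z ∧ G.Adj v z}.ncard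

/-- The graph left by Phase 1: an edge `(u, v)` of `G` is removed if `T^{uv} ≤ n E_T`, where `n` is
the number of nodes; triangles are counted in the original graph `G`. -/
def phase1 (G : SimpleGraph V) (E_T : ℝ) : SimpleGraph V where
  Adj u v := G.Adj u v ∧ ¬ ((triangleCount G u v : ℝ) ≤ Nat.card V * E_T)
  symm := ⟨fun u v h => by
    have e : triangleCount G v u = triangleCount G u v := by
      unfold triangleCount
      simp only [and_comm]
    exact ⟨h.1.symm, by rw [e]; exact h.2⟩⟩
  loopless := ⟨fun u h => G.irrefl h.1⟩

/-! ### Phase 2: the `S²` algorithm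

The label list is a partial labelling `L : V → Option Bool`; `L x = some a` says that `x` has been
queried and has label `a`. -/

/-- Both nodes have been queried, and their labels differ. -/
def Opposite (L : V → Option Bool) (u v : V) : Prop :=
  ∃ a b, L u = some a ∧ L v = some b ∧ a ≠ b

theorem Opposite.symm {L : V → Option Bool} {u v : V} (h : Opposite L u v) : Opposite L v u := by
  obtain ⟨a, b, ha, hb, hab⟩ := h
  exact ⟨b, a, hb, ha, hab.symm⟩

/-- Remove all edges between queried nodes with different labels. -/
def cut (H : SimpleGraph V) (L : V → Option Bool) : SimpleGraph V where
  Adj u v := H.Adj u v ∧ ¬ Opposite L u v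
  symm := ⟨fun _ _ h => ⟨h.1.symm, fun h' => h.2 h'.symm⟩⟩
  loopless := ⟨fun _ h => H.irrefl h.1⟩

/-- `x` is the midpoint of a shortest among all paths of `H` that join two queried nodes with
different labels, and this path has length at least 2. (A walk of minimal length is a path. For odd
length both middle nodes qualify, since the path can be read from either end.) -/
def IsMidpoint (H : SimpleGraph V) (L : V → Option Bool) (x : V) : Prop :=
  ∃ (u v : V) (p : H.Walk u v), Opposite L u v ∧
    (∀ (u' v' : V) (q : H.Walk u' v'), Opposite L u' v' → p.length ≤ q.length) ∧
    2 ≤ p.length ∧ x = p.getVert (p.length / 2)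

/-- An implementation of the subroutine MSSP: it returns a midpoint of a shortest shortest path
whenever there is one, and nothing otherwise. Implementations differ in how they break ties. -/
structure MSSP (V : Type*) where
  /-- the node returned, if any -/
  pick : SimpleGraph V → (V → Option Bool) → Option V
  isMidpoint_of_some : ∀ H L x, pick H L = some x → IsMidpoint H L x
  not_isMidpoint_of_none : ∀ H L, pick H L = none → ∀ x, ¬ IsMidpoint H L x

open Classical in
instance : Nonempty (MSSP V) :=
  ⟨{ pick := fun H L => if h : ∃ x, IsMidpoint H L x then some h.choose else none
     isMidpoint_of_some := by
       intro H L x hx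
       split_ifs at hx with h
       rw [← Option.some.inj hx]
       exact h.choose_spec
     not_isMidpoint_of_none := by
       intro H L hx x h'
       split_ifs at hx with h
       exact h ⟨x, h'⟩ }⟩

variable [Fintype V]

open Classical in
/-- The nodes that have not been queried. -/
def unlabeled (L : V → Option Bool) : Finset V := {x | L x = none}

/-- The law of the next node to query: MSSP if it returns a node, and otherwise a uniformly random
unlabeled node. -/
def nextQuery (M : MSSP V) (H : SimpleGraph V) (L : V → Option Bool)
    (hL : (unlabeled L).Nonempty) : PMF V :=
  match M.pick H L with
  | some x => PMF.pure x
  | none => PMF.uniformOfFinset (unlabeled L) hL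

open Classical in
/-- `S²` on the current graph `H` with label list `L` and label oracle `f`, stopped as soon as the
current graph has exactly two connected components (or no unlabeled node is left). Each round
queries one node `x`, adds `(x, f x)` to the label list and removes the edges between queried nodes
with different labels. The result is the law of the pair (partition of `V` into the connected
components of the final graph, number of queries made). The first argument bounds the number of
rounds; `card V` rounds always suffice, because each round queries a new node. -/
def s2 (M : MSSP V) (f : V → Bool) :
    ℕ → SimpleGraph V → (V → Option Bool) → PMF (Setoid V × ℕ)
  | 0, H, _ => PMF.pure (H.reachableSetoid, 0)
  | k + 1, H, L =>
    if Nat.card H.ConnectedComponent = 2 then PMF.pure (H.reachableSetoid, 0)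
    else if hL : (unlabeled L).Nonempty then
      (nextQuery M H L hL).bind fun x =>
        let L' := Function.update L x (some (f x))
        (s2 M f k (cut H L') L').map fun r => (r.1, r.2 + 1)
    else PMF.pure (H.reachableSetoid, 0)

/-- Motif counting with `S²`: Phase 1 with threshold `E_T`, then `S²` with no node queried yet.
The result is the joint law of the output partition and the number of label queries. -/
def motifS2 (M : MSSP V) (f : V → Bool) (G : SimpleGraph V) (E_T : ℝ) : PMF (Setoid V × ℕ) :=
  s2 M f (Fintype.card V) (phase1 G E_T) fun _ => none

end Algorithm

/-! ### The parameters -/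

/-- `t₁ = inf {t ≥ 0 : (2θ₂ + t) log ((2θ₂ + t) / (2θ₂)) - t > 1}`. -/
def t₁ (θ₂ : ℝ) : ℝ :=
  sInf {t : ℝ | 0 ≤ t ∧ (2 * θ₂ + t) * Real.log ((2 * θ₂ + t) / (2 * θ₂)) - t > 1}

/-- `η = inf {t ≥ 0 : (2θ₁ - 2 - t) log ((2θ₁ - 2 - t) / (2θ₁ - 2)) + t > 2}`.
If `θ₁ > 2`, the set has elements below `2θ₁ - 2`, so that the values of `t` for which the argument
of the logarithm is not positive play no role. If `θ₁ = 2`, no `t ≤ 2θ₁ - 2` satisfies the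
inequality, and the value is `2θ₁ - 2`, which makes the threshold zero. -/
def η (θ₁ : ℝ) : ℝ :=
  sInf {t : ℝ | 0 ≤ t ∧
    (2 * θ₁ - 2 - t) * Real.log ((2 * θ₁ - 2 - t) / (2 * θ₁ - 2)) + t > 2}

/-- The rescaled threshold `½ (2θ₁ - 2 - η)`. -/
def τ (θ₁ : ℝ) : ℝ := 1 / 2 * (2 * θ₁ - 2 - η θ₁)

/-- The threshold `E_T = ½ (2θ₁ - 2 - η) log n / n`. -/
def threshold (θ₁ : ℝ) (n : ℕ) : ℝ := τ θ₁ * (Real.log n / n)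

/-- The gap between the rescaled threshold and the mean `2θ₂` of the rescaled triangle count of a
cross-cluster edge. -/
def gap (θ₁ θ₂ : ℝ) : ℝ := τ θ₁ - 2 * θ₂

/-- The exponent `ε`. -/
def ε (θ₁ θ₂ : ℝ) : ℝ := τ θ₁ * Real.log (τ θ₁ / (2 * θ₂)) - (τ θ₁ - 2 * θ₂)

/-! ### Success probabilities -/

/-- The probability, over the features and the random choices of the algorithm, that motif counting
with `S²` run on the graph of the model returns exactly the partition into the two clusters
with a number of queries that satisfies `Q`. -/
def recoveryProb (n : ℕ) (θ₁ θ₂ : ℝ) (σ : Fin n → Bool) (M : MSSP (Fin n)) (Q : ℕ → Prop) :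
    ENNReal :=
  ∫⁻ X, (motifS2 M σ (graph θ₁ θ₂ σ X) (threshold θ₁ n)).toOuterMeasure
    {r | r.1 = Setoid.ker σ ∧ Q r.2} ∂featureLaw n

/-- The probability that after Phase 1 the connected components are exactly the two clusters. -/
def phase1RecoveryProb (n : ℕ) (θ₁ θ₂ : ℝ) (σ : Fin n → Bool) : ENNReal :=
  featureLaw n {X |
    (phase1 (graph θ₁ θ₂ σ X) (threshold θ₁ n)).reachableSetoid = Setoid.ker σ}

end GBM

end

/-! The features matter only through one event, the complement of `phase1Bad`: Phase 1 keeps each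
cluster connected and leaves few edges between the clusters. On this event the search is almost
deterministic.

Search. When both clusters are connected, the current graph is either connected or has exactly the
two clusters as components, so two components means a correct answer
(`ClusterConnected.reachable_iff_or`). Once both labels have been seen, each midpoint query removes
a cross edge or halves the shortest path between opposite labels; hence E cross edges cost about E
log₂ n queries (`s2_support`). Before that, balance makes each uniform query after the first miss
the other label with probability at most 1/2.

Connectivity. It suffices that nodes of a cluster that are consecutive on the line stay adjacent.
For c > 2, gaps longer than c log n / n are excluded by a union bound of order n^{1-c/2}. For
consecutive nodes at distance d log n / n, one Chernoff bound treats two events jointly: the gap is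
empty, and common neighbours are few. With discount ρ per common neighbour the exponent is d/2 +
(1-ρ)(θ₁-d) + τ log ρ: a longer gap loses common neighbours but is itself less likely to be empty.
The definition of η makes ρ = τ/(θ₁-1) give an exponent at least 1+κ for all d ≤ c (`exists_rates`),
which beats the order n log n of expected close pairs.

Cross edges. The third node of a triangle over a cross pair lies in the cluster opposite to one end,
hence within θ₂ log n / n of that end. Given the pair, the count is at most a sum of independent
indicators of mean at most 2θ₂ log n, and the Chernoff bound with tilt τ/(2θ₂) gives n^{-ε}. The
expected number of cross edges is therefore at most 2θ₂ n^{1-ε} log n, and Markov's inequality gives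
n^{1-ε} (log n)² with probability 1 - O(1/log n). If γ > t₁ then ε > 1 (`one_lt_ε`), and with high
probability no cross edge is left. -/

noncomputable section

namespace GBM

/-! ### The query process `S²` on graphs with connected clusters -/

section Search

variable {V : Type*}

/-- The edges of `H` inside the clusters of `f`. -/
def monoPart (H : SimpleGraph V) (f : V → Bool) : SimpleGraph V where
  Adj u v := H.Adj u v ∧ f u = f v
  symm := ⟨fun _ _ h => ⟨h.1.symm, h.2.symm⟩⟩
  loopless := ⟨fun _ h => H.irrefl h.1⟩

/-- Each cluster of `f` is connected by edges of `H` inside the cluster. -/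
def ClusterConnected (H : SimpleGraph V) (f : V → Bool) : Prop :=
  ∀ u v, f u = f v → (monoPart H f).Reachable u v

/-- The ordered pairs of adjacent nodes from different clusters. -/
def crossEdges (H : SimpleGraph V) (f : V → Bool) : Set (V × V) :=
  {e | f e.1 ≠ f e.2 ∧ H.Adj e.1 e.2}

/-- The label list agrees with the oracle. -/
def Consistent (L : V → Option Bool) (f : V → Bool) : Prop :=
  ∀ x a, L x = some a → a = f x

theorem Opposite.ne_of_consistent {L : V → Option Bool} {f : V → Bool} (hL : Consistent L f)
    {u v : V} (h : Opposite L u v) : f u ≠ f v := by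
  obtain ⟨a, b, ha, hb, hab⟩ := h
  rwa [← hL u a ha, ← hL v b hb]

theorem monoPart_le (H : SimpleGraph V) (f : V → Bool) : monoPart H f ≤ H := fun _ _ h => h.1

theorem cut_le (H : SimpleGraph V) (L : V → Option Bool) : cut H L ≤ H := fun _ _ h => h.1

theorem not_adj_cut {H : SimpleGraph V} {L : V → Option Bool} (u v : V) (h : Opposite L u v) :
    ¬ (cut H L).Adj u v := fun h' => h'.2 h

/-- Labels are true, so a cut only touches edges between clusters. This is the invariant that
survives every round. -/
theorem ClusterConnected.cut {H : SimpleGraph V} {f : V → Bool} (h : ClusterConnected H f)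
    {L : V → Option Bool} (hL : Consistent L f) : ClusterConnected (cut H L) f := fun u v huv =>
  (h u v huv).mono fun a b (h' : H.Adj a b ∧ f a = f b) =>
    show (GBM.cut H L).Adj a b ∧ f a = f b from
      ⟨⟨h'.1, fun ho => ho.ne_of_consistent hL h'.2⟩, h'.2⟩

theorem ClusterConnected.reachable {H : SimpleGraph V} {f : V → Bool} (h : ClusterConnected H f)
    {u v : V} (huv : f u = f v) : H.Reachable u v :=
  (h u v huv).mono (monoPart_le H f)

theorem crossEdges_mono {H H' : SimpleGraph V} (f : V → Bool) (h : H' ≤ H) :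
    crossEdges H' f ⊆ crossEdges H f := fun _ he => ⟨he.1, h he.2⟩

theorem card_components_of_reachable_iff {H : SimpleGraph V} {f : V → Bool}
    (hf : Function.Surjective f) (h : ∀ u v, H.Reachable u v ↔ f u = f v) :
    Nat.card H.ConnectedComponent = 2 := by
  have e : Function.Bijective (SimpleGraph.ConnectedComponent.lift f
      (fun u v p _ => (h u v).1 p.reachable) : H.ConnectedComponent → Bool) := by
    constructor
    · intro a b
      induction a using SimpleGraph.ConnectedComponent.ind
      induction b using SimpleGraph.ConnectedComponent.ind
      intro hab
      exact SimpleGraph.ConnectedComponent.sound ((h _ _).2 hab)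
    · intro b
      obtain ⟨x, rfl⟩ := hf b
      exact ⟨H.connectedComponentMk x, rfl⟩
  rw [Nat.card_congr (Equiv.ofBijective _ e)]
  simp

theorem reachableSetoid_eq_ker {H : SimpleGraph V} {f : V → Bool}
    (h : ∀ u v, H.Reachable u v ↔ f u = f v) : H.reachableSetoid = Setoid.ker f :=
  Setoid.ext fun u v => h u v

/-- A single path from one cluster to the other merges everything, because there are only two
connected blocks. Hence stopping at two components cannot return a wrong partition. -/
theorem ClusterConnected.reachable_iff_or {H : SimpleGraph V} {f : V → Bool}
    (h : ClusterConnected H f) :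
    (∀ u v, H.Reachable u v ↔ f u = f v) ∨ ∀ u v, H.Reachable u v := by
  by_cases hc : ∀ u v, H.Reachable u v → f u = f v
  · exact Or.inl fun u v => ⟨hc u v, h.reachable⟩
  · push Not at hc
    obtain ⟨u, v, huv, hne⟩ := hc
    refine Or.inr fun a b => ?_
    have key : ∀ a, H.Reachable u a := by
      intro a
      by_cases ha : f u = f a
      · exact h.reachable ha
      · refine huv.trans (h.reachable ?_)
        revert ha hne
        cases f u <;> cases f v <;> cases f a <;> simp
    exact (key a).symm.trans (key b)

theorem card_components_of_reachable {H : SimpleGraph V} (h : ∀ u v, H.Reachable u v) :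
    Nat.card H.ConnectedComponent ≠ 2 := by
  have : Subsingleton H.ConnectedComponent := by
    constructor
    intro a b
    induction a using SimpleGraph.ConnectedComponent.ind
    induction b using SimpleGraph.ConnectedComponent.ind
    exact SimpleGraph.ConnectedComponent.sound (h _ _)
  have := Finite.card_le_one_iff_subsingleton.2 this
  omega

theorem ClusterConnected.reachableSetoid_eq {H : SimpleGraph V} {f : V → Bool}
    (h : ClusterConnected H f) (h2 : Nat.card H.ConnectedComponent = 2) :
    H.reachableSetoid = Setoid.ker f := by
  rcases h.reachable_iff_or with h' | h'
  · exact reachableSetoid_eq_ker h'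
  · exact absurd h2 (card_components_of_reachable h')

theorem ClusterConnected.reachable_of_card {H : SimpleGraph V} {f : V → Bool}
    (hf : Function.Surjective f)
    (h : ClusterConnected H f) (h2 : Nat.card H.ConnectedComponent ≠ 2) (u v : V) :
    H.Reachable u v := by
  rcases h.reachable_iff_or with h' | h'
  · exact absurd (card_components_of_reachable_iff hf h') h2
  · exact h' u v

theorem reachable_iff_of_crossEdges_eq_empty {H : SimpleGraph V} {f : V → Bool}
    (h : ClusterConnected H f) (h0 : crossEdges H f = ∅) (u v : V) :
    H.Reachable u v ↔ f u = f v := by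
  refine ⟨fun ⟨p⟩ => ?_, h.reachable⟩
  induction p with
  | nil => rfl
  | @cons a b c hab p ih =>
    rw [← ih p.reachable]
    by_contra hne
    have : (a, b) ∈ crossEdges H f := ⟨hne, hab⟩
    simp [h0] at this

theorem Consistent.update [DecidableEq V] {L : V → Option Bool} {f : V → Bool}
    (hL : Consistent L f) (x : V) : Consistent (Function.update L x (some (f x))) f := by
  intro y a hy
  by_cases h : y = x
  · subst h
    simpa [eq_comm] using hy
  · rw [Function.update_of_ne h] at hy
    exact hL y a hy

theorem Opposite.update [DecidableEq V] {L : V → Option Bool} {u v x : V} (h : Opposite L u v)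
    (hx : L x = none) (c : Option Bool) : Opposite (Function.update L x c) u v := by
  obtain ⟨a, b, ha, hb, hab⟩ := h
  refine ⟨a, b, ?_, ?_, hab⟩
  · rw [Function.update_of_ne, ha]
    rintro rfl
    simp [hx] at ha
  · rw [Function.update_of_ne, hb]
    rintro rfl
    simp [hx] at hb

/-- A midpoint `x` has not been queried; once queried, it has a label different from that of one
end of the shortest path, and the corresponding half of the path joins the two. -/
theorem IsMidpoint.exists_half [DecidableEq V] {H : SimpleGraph V} {L : V → Option Bool}
    {f : V → Bool} {x u₀ v₀ : V} (h : IsMidpoint H L x)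
    (q : H.Walk u₀ v₀) (hq : Opposite L u₀ v₀) :
    L x = none ∧ ∃ l, 2 ≤ l ∧ l ≤ q.length ∧
      ∃ (a b : V) (r : H.Walk a b), Opposite (Function.update L x (some (f x))) a b ∧
        r.length ≤ (l + 1) / 2 := by
  obtain ⟨u, v, p, huv, hmin, h2, rfl⟩ := h
  set x := p.getVert (p.length / 2) with hx
  have l1 : (p.take (p.length / 2)).length = p.length / 2 := by simp; omega
  have l2 : (p.drop (p.length / 2)).length = p.length - p.length / 2 := by simp
  obtain ⟨a, b, ha, hb, hab⟩ := id huv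
  -- A labelled midpoint would be opposite to one of the ends, and the half path to that end would
  -- be shorter than the minimum; length at least 2 makes both halves strictly shorter.
  have hnone : L x = none := by
    rcases hc : L x with _ | c
    · rfl
    exfalso
    by_cases hac : a = c
    · have := hmin x v (p.drop (p.length / 2)) ⟨c, b, hc, hb, hac ▸ hab⟩
      omega
    · have := hmin u x (p.take (p.length / 2)) ⟨a, c, ha, hc, hac⟩
      omega
  have hxu : u ≠ x := fun e => by rw [e, hnone] at ha; simp at ha
  have hxv : v ≠ x := fun e => by rw [e, hnone] at hb; simp at hb
  refine ⟨hnone, p.length, h2, hmin _ _ q hq, ?_⟩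
  by_cases hac : a = f x
  · refine ⟨x, v, p.drop (p.length / 2), ⟨f x, b, by simp, ?_, hac ▸ hab⟩, by omega⟩
    rw [Function.update_of_ne hxv, hb]
  · refine ⟨u, x, p.take (p.length / 2), ⟨a, f x, ?_, by simp, hac⟩, by omega⟩
    rw [Function.update_of_ne hxu, ha]

/-- A shortest walk between opposite labels has length at least 2: length 0 would give one node two
labels, and edges of length 1 have been cut. -/
theorem MSSP.pick_ne_none (M : MSSP V) {H : SimpleGraph V} {L : V → Option Bool}
    (hcut : ∀ u v, Opposite L u v → ¬ H.Adj u v) {u v : V} (huv : Opposite L u v)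
    (p : H.Walk u v) : M.pick H L ≠ none := by
  classical
  intro hnone
  let S : Set ℕ := {l | ∃ (u v : V) (p : H.Walk u v), Opposite L u v ∧ p.length = l}
  have hS : ∃ l, l ∈ S := ⟨p.length, u, v, p, huv, rfl⟩
  obtain ⟨a, b, q, hab, hq⟩ := Nat.find_spec hS
  refine M.not_isMidpoint_of_none H L hnone _ ⟨a, b, q, hab, ?_, ?_, rfl⟩
  · intro a' b' q' h'
    rw [hq]
    exact Nat.find_min' hS ⟨a', b', q', h', rfl⟩
  · by_contra hlt
    have : q.length = 0 ∨ q.length = 1 := by omega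
    rcases this with h0 | h1
    · have := SimpleGraph.Walk.eq_of_length_eq_zero h0
      subst this
      obtain ⟨c, d, hc, hd, hcd⟩ := hab
      rw [hc] at hd
      exact hcd (Option.some.inj hd)
    · exact hcut a b hab (SimpleGraph.Walk.adj_of_length_eq_one h1)

variable [Fintype V]

theorem card_unlabeled_update [DecidableEq V] {L : V → Option Bool} {x : V} (hx : L x = none)
    (b : Bool) : (unlabeled (Function.update L x (some b))).card + 1 = (unlabeled L).card := by
  have : unlabeled (Function.update L x (some b)) = (unlabeled L).erase x := by
    ext y
    by_cases h : y = x
    · subst h; simp [unlabeled]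
    · simp [unlabeled, h]
  rw [this, Finset.card_erase_add_one]
  simpa [unlabeled] using hx

theorem crossEdges_eq_empty_of_unlabeled {H : SimpleGraph V} {L : V → Option Bool} {f : V → Bool}
    (hL : Consistent L f) (hcut : ∀ u v, Opposite L u v → ¬ H.Adj u v)
    (h0 : unlabeled L = ∅) : crossEdges H f = ∅ := by
  have key : ∀ x, L x = some (f x) := by
    intro x
    have : x ∉ unlabeled L := by simp [h0]
    rcases hx : L x with _ | a
    · simp [unlabeled, hx] at this
    · rw [hL x a hx]
  refine Set.eq_empty_of_forall_notMem fun e he => ?_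
  exact hcut e.1 e.2 ⟨_, _, key _, key _, he.1⟩ he.2

/-- Once both labels have been seen, every query of `S²` halves the length of a shortest shortest
path or removes an edge between the clusters. -/
theorem s2_support (M : MSSP V) {f : V → Bool} (hf : Function.Surjective f) (k : ℕ)
    (H : SimpleGraph V) (L : V → Option Bool) (E l : ℕ) (hL : Consistent L f)
    (hcut : ∀ u v, Opposite L u v → ¬ H.Adj u v) (hH : ClusterConnected H f)
    (hk : (unlabeled L).card ≤ k) (hE : (crossEdges H f).ncard ≤ E)
    (hl : (∀ u v, H.Reachable u v) →
      ∃ (u v : V) (p : H.Walk u v), Opposite L u v ∧ p.length ≤ l)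
    (r : Setoid V × ℕ) (hr : r ∈ (s2 M f k H L).support) :
    r.1 = Setoid.ker f ∧ r.2 ≤ E * (Nat.clog 2 (Fintype.card V) + 1) + Nat.clog 2 l := by
  induction k generalizing H L E l r with
  | zero =>
    have h0 : unlabeled L = ∅ := by simpa using hk
    simp only [s2, PMF.support_pure, Set.mem_singleton_iff] at hr
    subst hr
    exact ⟨reachableSetoid_eq_ker (reachable_iff_of_crossEdges_eq_empty hH
      (crossEdges_eq_empty_of_unlabeled hL hcut h0)), Nat.zero_le _⟩
  | succ k ih =>
    rw [s2] at hr
    by_cases h2 : Nat.card H.ConnectedComponent = 2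
    · rw [if_pos h2] at hr
      simp only [PMF.support_pure, Set.mem_singleton_iff] at hr
      subst hr
      exact ⟨hH.reachableSetoid_eq h2, Nat.zero_le _⟩
    rw [if_neg h2] at hr
    have hreach := hH.reachable_of_card hf h2
    obtain ⟨u, v, p, huv, hp⟩ := hl hreach
    have hpick := M.pick_ne_none hcut huv p
    obtain ⟨x, hx⟩ := Option.ne_none_iff_exists'.1 hpick
    classical
    obtain ⟨hxn, l₀, h2l, hl₀, a, b, w, hab, hw⟩ :=
      (M.isMidpoint_of_some H L x hx).exists_half p huv
    have hne : (unlabeled L).Nonempty := ⟨x, by simpa [unlabeled] using hxn⟩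
    rw [dif_pos hne] at hr
    have hq : nextQuery M H L hne = PMF.pure x := by
      simp only [nextQuery, hx]
    rw [hq, PMF.pure_bind] at hr
    simp only [PMF.support_map, Set.mem_image] at hr
    obtain ⟨r', hr', rfl⟩ := hr
    set L' := Function.update L x (some (f x)) with hL'
    have hr'' : r' ∈ (s2 M f k (GBM.cut H L') L').support := by
      convert hr'
    have hcons : Consistent L' f := hL.update x
    have hk' : (unlabeled L').card ≤ k := by
      have : (unlabeled L').card + 1 = _ := card_unlabeled_update hxn (f x)
      omega
    have hfin : (crossEdges H f).Finite := Set.toFinite _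
    have huv' : Opposite L' u v := huv.update hxn _
    -- The potential is E (⌈log₂ |V|⌉ + 1) + ⌈log₂ l⌉. If nothing is cut, the half path survives and
    -- the second term drops by one.
    by_cases hsame : GBM.cut H L' = H
    · have := ih (GBM.cut H L') L' E ((l₀ + 1) / 2) hcons not_adj_cut (hH.cut hcons) hk'
        (by rw [hsame]; exact hE) (by rw [hsame]; exact fun _ => ⟨a, b, w, hab, hw⟩) r' hr''
      refine ⟨this.1, ?_⟩
      have e : Nat.clog 2 l₀ = Nat.clog 2 ((l₀ + 1) / 2) + 1 := Nat.clog_of_two_le (by norm_num) h2l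
      have e2 : Nat.clog 2 l₀ ≤ Nat.clog 2 l := Nat.clog_mono_right 2 (hl₀.trans hp)
      have := this.2
      simp only
      omega
    · have hlt : (crossEdges (GBM.cut H L') f).ncard < (crossEdges H f).ncard := by
        refine Set.ncard_lt_ncard (ssubset_of_subset_of_ne (crossEdges_mono f (cut_le H L')) ?_) hfin
        intro heq
        refine hsame (le_antisymm (cut_le H L') fun c d hcd => ⟨hcd, fun ho => ?_⟩)
        have hmem : (c, d) ∈ crossEdges (GBM.cut H L') f := by
          rw [heq]
          exact ⟨ho.ne_of_consistent hcons, hcd⟩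
        exact hmem.2.2 ho
      obtain ⟨E', rfl⟩ : ∃ E', E = E' + 1 := ⟨E - 1, by omega⟩
      -- A lost cross edge pays for this query and for resetting the path bound to |V|; a path
      -- between the old opposite nodes `u`, `v` is needed only if the graph is still connected.
      have := ih (GBM.cut H L') L' E' (Fintype.card V) hcons not_adj_cut (hH.cut hcons) hk'
        (by omega) (fun hr => by
          obtain ⟨p', hp'⟩ := (hr u v).exists_isPath
          exact ⟨u, v, p', huv', hp'.length_lt.le⟩) r' hr''
      refine ⟨this.1, ?_⟩
      have := this.2
      simp only
      rw [add_mul]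
      omega

/-- With both labels seen, `S²` surely succeeds within the query budget. -/
theorem s2_failure_eq_zero (M : MSSP V) {f : V → Bool} (hf : Function.Surjective f) (k : ℕ)
    (H : SimpleGraph V) (L : V → Option Bool) (E B : ℕ) (hL : Consistent L f)
    (hcut : ∀ u v, Opposite L u v → ¬ H.Adj u v) (hH : ClusterConnected H f)
    (hk : (unlabeled L).card ≤ k) (hE : (crossEdges H f).ncard ≤ E)
    (hopp : ∃ u v, Opposite L u v)
    (hB : E * (Nat.clog 2 (Fintype.card V) + 1) + Nat.clog 2 (Fintype.card V) ≤ B) :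
    (s2 M f k H L).toOuterMeasure {r | ¬ (r.1 = Setoid.ker f ∧ r.2 ≤ B)} = 0 := by
  rw [PMF.toOuterMeasure_apply_eq_zero_iff, Set.disjoint_left]
  intro r hr hr'
  obtain ⟨u, v, huv⟩ := hopp
  have := s2_support M hf k H L E (Fintype.card V) hL hcut hH hk hE (fun h => by
    obtain ⟨p, hp⟩ := (h u v).exists_isPath
    exact ⟨u, v, p, huv, hp.length_lt.le⟩) r hr
  exact hr' ⟨this.1, this.2.trans hB⟩

theorem PMF.toOuterMeasure_le_one {α : Type*} (p : PMF α) (s : Set α) :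
    p.toOuterMeasure s ≤ 1 := by
  rw [PMF.toOuterMeasure_apply, ← p.tsum_coe]
  exact ENNReal.tsum_le_tsum fun a => Set.indicator_le_self s _ a

open Classical in
/-- One round of `S²` when no path joins queried nodes with different labels. -/
theorem s2_failure_succ (M : MSSP V) {f : V → Bool} (k : ℕ)
    (H : SimpleGraph V) (L : V → Option Bool) (B : ℕ) (hH : ClusterConnected H f)
    (hopp : ∀ u v, ¬ Opposite L u v) (hne : (unlabeled L).Nonempty) :
    (s2 M f (k + 1) H L).toOuterMeasure {r | ¬ (r.1 = Setoid.ker f ∧ r.2 ≤ B + 1)} ≤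
      ∑' x, PMF.uniformOfFinset (unlabeled L) hne x *
        (s2 M f k (cut H (Function.update L x (some (f x))))
          (Function.update L x (some (f x)))).toOuterMeasure
          {r | ¬ (r.1 = Setoid.ker f ∧ r.2 ≤ B)} := by
  rw [s2]
  split_ifs with h2
  · refine le_of_eq_of_le ?_ zero_le
    rw [PMF.toOuterMeasure_apply_eq_zero_iff, Set.disjoint_left]
    intro r hr hr'
    simp only [PMF.support_pure, Set.mem_singleton_iff] at hr
    subst hr
    exact hr' ⟨hH.reachableSetoid_eq h2, Nat.zero_le _⟩
  · have hpick : M.pick H L = none := by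
      rcases h : M.pick H L with _ | x
      · rfl
      · obtain ⟨u, v, _, huv, _⟩ := M.isMidpoint_of_some H L x h
        exact absurd huv (hopp u v)
    have hq : nextQuery M H L hne = PMF.uniformOfFinset (unlabeled L) hne := by
      simp only [nextQuery, hpick]
    rw [hq, PMF.toOuterMeasure_bind_apply]
    refine le_of_eq (tsum_congr fun x => ?_)
    simp only [PMF.toOuterMeasure_map_apply]
    congr 2
    ext r
    simp

open Classical in
/-- While all queried nodes have label `b`, a random query has the other label with probability at
least `1 / 2`. -/
theorem s2_failure_le_of_label (M : MSSP V) {f : V → Bool} (hf : Function.Surjective f)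
    (hbal : ∀ b, 2 * (Finset.univ.filter fun x => f x = b).card = Fintype.card V)
    (b : Bool) (E B : ℕ)
    (hB : E * (Nat.clog 2 (Fintype.card V) + 1) + Nat.clog 2 (Fintype.card V) ≤ B)
    (k j : ℕ) (H : SimpleGraph V) (L : V → Option Bool) (hL : Consistent L f)
    (hH : ClusterConnected H f)
    (hk : (unlabeled L).card ≤ k) (hE : (crossEdges H f).ncard ≤ E)
    (hsome : ∃ x, L x = some b) (hall : ∀ x a, L x = some a → a = b) :
    (s2 M f k H L).toOuterMeasure {r | ¬ (r.1 = Setoid.ker f ∧ r.2 ≤ B + j)} ≤ (2⁻¹) ^ j := by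
  have hopp : ∀ u v, ¬ Opposite L u v := by
    rintro u v ⟨c, d, hc, hd, hcd⟩
    exact hcd ((hall _ _ hc).trans (hall _ _ hd).symm)
  have hun : ∀ x, f x ≠ b → x ∈ unlabeled L := by
    intro x hx
    rcases h : L x with _ | a
    · simpa [unlabeled] using h
    · exact absurd ((hL x a h).symm.trans (hall x a h)) hx
  have hne : (unlabeled L).Nonempty := by
    obtain ⟨x, hx⟩ := hf (!b)
    exact ⟨x, hun x (by simp [hx])⟩
  induction k generalizing j H L with
  | zero => simp at hk; simp [hk] at hne
  | succ k ih =>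
    rcases j with _ | j
    · simpa using PMF.toOuterMeasure_le_one _ _
    refine (s2_failure_succ M k H L (B + j) hH hopp hne).trans ?_
    -- A query showing the other label leads to the deterministic regime, where failure has
    -- probability zero; only queries with label `b` contribute, and these use up one of the `j`
    -- spare queries.
    have hstep : ∀ x, PMF.uniformOfFinset (unlabeled L) hne x *
        (s2 M f k (cut H (Function.update L x (some (f x))))
          (Function.update L x (some (f x)))).toOuterMeasure
          {r | ¬ (r.1 = Setoid.ker f ∧ r.2 ≤ B + j)} ≤
        {x | f x = b}.indicator (PMF.uniformOfFinset (unlabeled L) hne) x * (2⁻¹) ^ j := by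
      intro x
      by_cases hxn : x ∈ unlabeled L
      swap
      · rw [PMF.uniformOfFinset_apply_of_notMem hne hxn]; simp
      have hxn' : L x = none := by simpa [unlabeled] using hxn
      have hcons := hL.update x
      have hk' : (unlabeled (Function.update L x (some (f x)))).card ≤ k := by
        have := card_unlabeled_update hxn' (f x)
        omega
      have hE' : (crossEdges (cut H (Function.update L x (some (f x)))) f).ncard ≤ E :=
        (Set.ncard_le_ncard (crossEdges_mono f (cut_le _ _)) (Set.toFinite _)).trans hE
      obtain ⟨y, hy⟩ := hsome
      have hyx : y ≠ x := by rintro rfl; simp [hxn'] at hy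
      by_cases hxb : f x = b
      · rw [Set.indicator_of_mem (by exact hxb)]
        gcongr
        have hall' : ∀ z a, Function.update L x (some (f x)) z = some a → a = b := by
          intro z a hz
          by_cases hzx : z = x
          · subst hzx
            simp at hz
            rw [← hz, hxb]
          · rw [Function.update_of_ne hzx] at hz
            exact hall z a hz
        have hun' : ∀ z, f z ≠ b → z ∈ unlabeled (Function.update L x (some (f x))) := by
          intro z hz
          have hzx : z ≠ x := by rintro rfl; exact hz hxb
          have := hun z hz
          simpa [unlabeled, hzx] using this
        refine ih j _ _ hcons (hH.cut hcons) hk' hE' ⟨x, by simp [hxb]⟩ hall' ?_ hun' ?_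
        · rintro u v ⟨c, d, hc, hd, hcd⟩
          exact hcd ((hall' _ _ hc).trans (hall' _ _ hd).symm)
        · obtain ⟨z, hz⟩ := hf (!b)
          exact ⟨z, hun' z (by simp [hz])⟩
      · rw [s2_failure_eq_zero M hf k _ _ E (B + j) hcons not_adj_cut (hH.cut hcons) hk' hE' ?_
          (by omega), mul_zero]
        · exact zero_le
        · refine ⟨x, y, f x, b, by simp, ?_, hxb⟩
          rw [Function.update_of_ne hyx, hy]
    refine (ENNReal.tsum_le_tsum hstep).trans ?_
    rw [ENNReal.tsum_mul_right, ← PMF.toOuterMeasure_apply,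
      PMF.toOuterMeasure_uniformOfFinset_apply, pow_succ']
    gcongr
    -- The whole other cluster, half of all nodes, is still unlabelled, while at most half of all
    -- nodes have label `b`.
    have hcard : 2 * ((unlabeled L).filter fun x => x ∈ {x | f x = b}).card ≤
        (unlabeled L).card := by
      have h1 : ((unlabeled L).filter fun x => f x = b).card +
          ((unlabeled L).filter fun x => ¬ f x = b).card = (unlabeled L).card :=
        Finset.card_filter_add_card_filter_not _
      have h2 : ((unlabeled L).filter fun x => f x = b).card ≤
          (Finset.univ.filter fun x => f x = b).card :=
        Finset.card_le_card (Finset.filter_subset_filter _ (Finset.subset_univ _))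
      have h3 : (Finset.univ.filter fun x => f x = !b).card ≤
          ((unlabeled L).filter fun x => ¬ f x = b).card := by
        refine Finset.card_le_card fun x hx => ?_
        have : f x ≠ b := by
          simp only [Finset.mem_filter, Finset.mem_univ, true_and] at hx
          simp [hx]
        simpa [this] using hun x this
      have h4 := hbal b
      have h5 := hbal (!b)
      simp only [Set.mem_ofPred_eq]
      omega
    have hpos : (0 : ENNReal) < (unlabeled L).card := by exact_mod_cast hne.card_pos
    rw [ENNReal.div_le_iff_le_mul (Or.inl hpos.ne') (Or.inl (by simp)), mul_comm,
      ← div_eq_mul_inv, ENNReal.le_div_iff_mul_le (Or.inl (by simp)) (Or.inl (by simp))]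
    rw [mul_comm]
    have hcast : ((2 * ((unlabeled L).filter fun x => x ∈ {x | f x = b}).card : ℕ) : ENNReal) ≤
        (unlabeled L).card := Nat.cast_le.2 hcard
    rw [Nat.cast_mul, Nat.cast_ofNat] at hcast
    convert hcast

/-- `S²` started without labels, on a graph whose clusters are connected. -/
theorem s2_failure_le (M : MSSP V) {f : V → Bool} (hf : Function.Surjective f)
    (hbal : ∀ b, 2 * {x | f x = b}.ncard = Fintype.card V)
    (H : SimpleGraph V) (hH : ClusterConnected H f) (B j : ℕ)
    (hB : (crossEdges H f).ncard * (Nat.clog 2 (Fintype.card V) + 1) +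
      Nat.clog 2 (Fintype.card V) ≤ B) :
    (s2 M f (Fintype.card V) H fun _ => none).toOuterMeasure
      {r | ¬ (r.1 = Setoid.ker f ∧ r.2 ≤ B + j + 1)} ≤ (2⁻¹) ^ j := by
  classical
  have hbal' : ∀ b, 2 * (Finset.univ.filter fun x => f x = b).card = Fintype.card V := by
    intro b
    rw [← hbal b, Set.ncard_eq_toFinset_card', Set.toFinset_ofPred]
  set L : V → Option Bool := fun _ => none with hLdef
  have hL : Consistent L f := by intro x a h; simp [hLdef] at h
  obtain ⟨x₀, _⟩ := hf true
  have hun : unlabeled L = Finset.univ := by ext; simp [unlabeled, hLdef]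
  have hne : (unlabeled L).Nonempty := ⟨x₀, by simp [hun]⟩
  obtain ⟨k, hk⟩ : ∃ k, Fintype.card V = k + 1 :=
    ⟨Fintype.card V - 1, by have := Fintype.card_pos_iff.2 ⟨x₀⟩; omega⟩
  have hk' : (unlabeled L).card = k + 1 := by rw [hun, Finset.card_univ, hk]
  have hgoal := s2_failure_succ M k H L (B + j) hH (by
    rintro u v ⟨c, d, hc, _⟩; simp [hLdef] at hc) hne
  rw [← hk] at hgoal
  refine hgoal.trans ?_
  -- The first query, the `+ 1` in the budget, only determines which label `b` is seen first.
  calc _ ≤ ∑' x, PMF.uniformOfFinset (unlabeled L) hne x * (2⁻¹) ^ j := by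
        refine ENNReal.tsum_le_tsum fun x => ?_
        gcongr
        have hcons := hL.update x
        refine s2_failure_le_of_label M hf hbal' (f x) _ B hB k j _ _ hcons (hH.cut hcons) ?_
          (Set.ncard_le_ncard (crossEdges_mono f (cut_le _ _)) (Set.toFinite _))
          ⟨x, by simp⟩ ?_
        · have := card_unlabeled_update (L := L) (x := x) rfl (f x)
          omega
        · intro z a hz
          by_cases hzx : z = x
          · subst hzx; simpa [eq_comm] using hz
          · simp [Function.update_of_ne hzx, hLdef] at hz
    _ = (2⁻¹) ^ j := by rw [ENNReal.tsum_mul_right, PMF.tsum_coe, one_mul]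

/-- No query is made when the graph has no edge between the clusters. -/
theorem s2_of_crossEdges_eq_empty (M : MSSP V) {f : V → Bool} (hf : Function.Surjective f)
    (H : SimpleGraph V) (hH : ClusterConnected H f) (h0 : crossEdges H f = ∅) :
    (s2 M f (Fintype.card V) H fun _ => none) = PMF.pure (Setoid.ker f, 0) := by
  have h := reachable_iff_of_crossEdges_eq_empty hH h0
  obtain ⟨x₀, _⟩ := hf true
  obtain ⟨k, hk⟩ : ∃ k, Fintype.card V = k + 1 :=
    ⟨Fintype.card V - 1, by have := Fintype.card_pos_iff.2 ⟨x₀⟩; omega⟩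
  rw [hk, s2, if_pos (card_components_of_reachable_iff hf h), reachableSetoid_eq_ker h]

end Search

/-! ### Exponential moments under a product law, given one or two coordinates -/

section Conditioning

variable {ι : Type*} [Fintype ι] (μ : Measure ℝ) [IsProbabilityMeasure μ]

theorem lintegral_pi_prod (g : ι → ℝ → ENNReal) (hg : ∀ i, Measurable (g i)) :
    ∫⁻ x, ∏ i, g i (x i) ∂(Measure.pi fun _ : ι => μ) = ∏ i, ∫⁻ t, g i t ∂μ := by
  have h := ProbabilityTheory.iIndepFun_pi (μ := fun _ : ι => μ) (X := fun i => g i)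
    fun i => (hg i).aemeasurable
  rw [ProbabilityTheory.lintegral_prod_eq_prod_lintegral_of_indepFun Finset.univ _ h]
  · refine Finset.prod_congr rfl fun i _ => ?_
    exact (measurePreserving_eval (fun _ : ι => μ) i).lintegral_comp (hg i)
  · exact fun i => (hg i).comp (measurable_pi_apply i)

/-- Conditioning on the coordinates in `p`. -/
theorem lintegral_pi_mul_prod_le (p : ι → Prop) [DecidablePred p]
    (F : ({i // p i} → ℝ) → ENNReal) (hF : Measurable F)
    (g : {i // ¬ p i} → ({i // p i} → ℝ) → ℝ → ENNReal)
    (hg : ∀ i, Measurable (Function.uncurry (g i))) (B : ENNReal)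
    (hB : ∀ a, F a ≠ 0 → ∏ i, ∫⁻ t, g i a t ∂μ ≤ B) :
    ∫⁻ x, F (fun i => x i) * ∏ i : {i // ¬ p i}, g i (fun j => x j) (x i)
        ∂(Measure.pi fun _ : ι => μ) ≤
      B * ∫⁻ x, F (fun i => x i) ∂(Measure.pi fun _ : ι => μ) := by
  have mp := measurePreserving_piEquivPiSubtypeProd (fun _ : ι => μ) p
  have hm : ∀ i : {i // ¬ p i}, Measurable
      fun z : ({i // p i} → ℝ) × ({i // ¬ p i} → ℝ) => g i z.1 (z.2 i) := fun i =>
    (hg i).comp (measurable_fst.prodMk ((measurable_pi_apply i).comp measurable_snd))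
  have hm1 : Measurable fun z : ({i // p i} → ℝ) × ({i // ¬ p i} → ℝ) =>
      F z.1 * ∏ i : {i // ¬ p i}, g i z.1 (z.2 i) :=
    (hF.comp measurable_fst).mul (Finset.measurable_prod _ fun i _ => hm i)
  have e1 := mp.lintegral_comp hm1
  have e2 := mp.lintegral_comp (hF.comp measurable_fst)
  have e1' : ∫⁻ x, F (fun i => x i) * ∏ i : {i // ¬ p i}, g i (fun j => x j) (x i)
        ∂(Measure.pi fun _ : ι => μ) = _ := e1
  have e2' : ∫⁻ x, F (fun i => x i) ∂(Measure.pi fun _ : ι => μ) = _ := e2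
  rw [e1', e2', lintegral_prod _ hm1.aemeasurable,
    lintegral_prod _ (hF.comp measurable_fst).aemeasurable, ← lintegral_const_mul]
  · refine lintegral_mono fun a => ?_
    simp only [Function.comp, lintegral_const, measure_univ, mul_one]
    rw [lintegral_const_mul, lintegral_pi_prod]
    · by_cases h : F a = 0
      · simp [h]
      · rw [mul_comm]
        gcongr
        exact hB a h
    · exact fun i => (hg i).comp (measurable_const.prodMk measurable_id)
    · exact Finset.measurable_prod _ fun i _ => (hm i).comp (measurable_const.prodMk measurable_id)
  · simpa [Function.comp] using hF

/-- Conditioning on one coordinate. -/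
theorem lintegral_pi_single_le [DecidableEq ι] (u : ι) (D : Set ℝ) (hD : MeasurableSet D)
    (g : ι → ℝ → ℝ → ENNReal) (hg : ∀ i, Measurable (Function.uncurry (g i)))
    (B : ENNReal) (hB : ∀ x ∈ D, ∏ i ∈ {u}ᶜ, ∫⁻ t, g i x t ∂μ ≤ B) :
    ∫⁻ X, D.indicator 1 (X u) * ∏ i ∈ {u}ᶜ, g i (X u) (X i) ∂(Measure.pi fun _ : ι => μ) ≤ B := by
  have h := lintegral_pi_mul_prod_le μ (fun i => i = u) (fun a => D.indicator 1 (a ⟨u, rfl⟩))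
    ((measurable_one.indicator hD).comp (measurable_pi_apply _))
    (fun i a t => g i (a ⟨u, rfl⟩) t)
    (fun i => (hg i).comp (show Measurable fun z : ({i // i = u} → ℝ) × ℝ =>
      (z.1 ⟨u, rfl⟩, z.2) by fun_prop))
    B (fun a ha => by
      have haD : a ⟨u, rfl⟩ ∈ D := by
        by_contra hn
        exact ha (Set.indicator_of_notMem hn _)
      refine le_of_eq_of_le ?_ (hB _ haD)
      rw [Finset.prod_subtype ({u}ᶜ : Finset ι) (p := fun i => ¬ i = u) (by simp)])
  calc _ = _ := lintegral_congr fun X => by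
        rw [Finset.prod_subtype ({u}ᶜ : Finset ι) (p := fun i => ¬ i = u) (by simp)]
    _ ≤ _ := h
    _ ≤ B * 1 := by
        gcongr
        calc ∫⁻ x : ι → ℝ, D.indicator (1 : ℝ → ENNReal) (x u) ∂(Measure.pi fun _ : ι => μ)
            ≤ ∫⁻ x, 1 ∂(Measure.pi fun _ : ι => μ) :=
              lintegral_mono fun x => Set.indicator_le_self' (fun _ _ => zero_le) _
          _ = 1 := by simp
    _ = B := mul_one B

/-- Conditioning on two coordinates. -/
theorem lintegral_pi_pair_le [DecidableEq ι] (u v : ι) (D : Set (ℝ × ℝ)) (hD : MeasurableSet D)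
    (g : ι → ℝ → ℝ → ℝ → ENNReal)
    (hg : ∀ i, Measurable fun z : ℝ × ℝ × ℝ => g i z.1 z.2.1 z.2.2)
    (B : ENNReal) (hB : ∀ x y, (x, y) ∈ D → ∏ i ∈ {u, v}ᶜ, ∫⁻ t, g i x y t ∂μ ≤ B) :
    ∫⁻ X, D.indicator 1 (X u, X v) * ∏ i ∈ {u, v}ᶜ, g i (X u) (X v) (X i)
        ∂(Measure.pi fun _ : ι => μ) ≤
      B * (Measure.pi fun _ : ι => μ) {X | (X u, X v) ∈ D} := by
  have hu : u = u ∨ u = v := Or.inl rfl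
  have hv : v = u ∨ v = v := Or.inr rfl
  have hmem : ∀ i, i ∈ ({u, v}ᶜ : Finset ι) ↔ ¬ (i = u ∨ i = v) := by simp
  have h := lintegral_pi_mul_prod_le μ (fun i => i = u ∨ i = v)
    (fun a => D.indicator 1 (a ⟨u, hu⟩, a ⟨v, hv⟩))
    ((measurable_one.indicator hD).comp ((measurable_pi_apply _).prodMk (measurable_pi_apply _)))
    (fun i a t => g i (a ⟨u, hu⟩) (a ⟨v, hv⟩) t)
    (fun i => (hg i).comp (show Measurable fun z : ({i // i = u ∨ i = v} → ℝ) × ℝ =>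
      (z.1 ⟨u, hu⟩, z.1 ⟨v, hv⟩, z.2) by fun_prop))
    B (fun a ha => by
      have haD : (a ⟨u, hu⟩, a ⟨v, hv⟩) ∈ D := by
        by_contra hn
        exact ha (Set.indicator_of_notMem hn _)
      refine le_of_eq_of_le ?_ (hB _ _ haD)
      rw [Finset.prod_subtype _ hmem])
  calc _ = _ := lintegral_congr fun X => by rw [Finset.prod_subtype _ hmem]
    _ ≤ _ := h
    _ = _ := by
        congr 1
        have hm : Measurable fun X : ι → ℝ => (X u, X v) :=
          (measurable_pi_apply _).prodMk (measurable_pi_apply _)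
        exact lintegral_indicator_one (hm hD)

/-- A Chernoff bound given one coordinate. -/
theorem measure_pi_single_le [DecidableEq ι] (u : ι) (D : Set ℝ) (hD : MeasurableSet D)
    (g : ι → ℝ → ℝ → ENNReal) (hg : ∀ i, Measurable (Function.uncurry (g i)))
    (B : ENNReal) (hB : ∀ x ∈ D, ∏ i ∈ {u}ᶜ, ∫⁻ t, g i x t ∂μ ≤ B) (S : Set (ι → ℝ))
    (hS : ∀ X ∈ S, X u ∈ D ∧ 1 ≤ ∏ i ∈ {u}ᶜ, g i (X u) (X i)) :
    (Measure.pi fun _ : ι => μ) S ≤ B := by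
  have hm : Measurable fun X : ι → ℝ => D.indicator 1 (X u) * ∏ i ∈ {u}ᶜ, g i (X u) (X i) := by
    refine ((measurable_one.indicator hD).comp (measurable_pi_apply u)).mul
      (Finset.measurable_prod _ fun i _ => (hg i).comp (show Measurable fun X : ι → ℝ =>
        (X u, X i) by fun_prop))
  refine le_trans ?_ (lintegral_pi_single_le μ u D hD g hg B hB)
  refine le_trans (measure_mono fun X hX => ?_)
    ((one_mul _).symm.le.trans (mul_meas_ge_le_lintegral hm 1))
  obtain ⟨h1, h2⟩ := hS X hX
  simpa [h1] using h2

/-- A Chernoff bound given two coordinates. -/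
theorem measure_pi_pair_le [DecidableEq ι] (u v : ι) (D : Set (ℝ × ℝ)) (hD : MeasurableSet D)
    (g : ι → ℝ → ℝ → ℝ → ENNReal)
    (hg : ∀ i, Measurable fun z : ℝ × ℝ × ℝ => g i z.1 z.2.1 z.2.2)
    (B c : ENNReal) (hB : ∀ x y, (x, y) ∈ D → ∏ i ∈ {u, v}ᶜ, ∫⁻ t, g i x y t ∂μ ≤ B)
    (S : Set (ι → ℝ))
    (hS : ∀ X ∈ S, (X u, X v) ∈ D ∧ c ≤ ∏ i ∈ {u, v}ᶜ, g i (X u) (X v) (X i)) :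
    c * (Measure.pi fun _ : ι => μ) S ≤
      B * (Measure.pi fun _ : ι => μ) {X | (X u, X v) ∈ D} := by
  have hm : Measurable fun X : ι → ℝ =>
      D.indicator 1 (X u, X v) * ∏ i ∈ {u, v}ᶜ, g i (X u) (X v) (X i) := by
    refine ((measurable_one.indicator hD).comp
      ((measurable_pi_apply u).prodMk (measurable_pi_apply v))).mul
      (Finset.measurable_prod _ fun i _ => (hg i).comp (show Measurable fun X : ι → ℝ =>
        (X u, X v, X i) by fun_prop))
  refine le_trans ?_ (lintegral_pi_pair_le μ u v D hD g hg B hB)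
  refine le_trans ?_ (mul_meas_ge_le_lintegral hm c)
  gcongr
  intro X hX
  obtain ⟨h1, h2⟩ := hS X hX
  simpa [h1] using h2

end Conditioning

/-! ### Lengths of arcs on the circle, read on the unit interval -/

section Line

/-- The uniform law on the unit interval. -/
abbrev unif : Measure ℝ := (volume : Measure ℝ).restrict (Set.Icc 0 1)

instance : IsProbabilityMeasure unif := ⟨by simp⟩

theorem measurable_circDist : Measurable fun z : ℝ × ℝ => circDist z.1 z.2 := by
  have hc : Continuous fun z : ℝ × ℝ => circDist z.1 z.2 := by
    unfold circDist
    fun_prop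
  exact hc.measurable

theorem min_one_add_max_sub (a : ℝ) : min 1 a + max 0 (a - 1) = a := by
  rcases le_total 1 a with h | h
  · rw [min_eq_left h, max_eq_right (by linarith)]; ring
  · rw [min_eq_right h, max_eq_left (by linarith)]; ring

theorem max_zero_add_min_add (a : ℝ) : max 0 a + min 1 (a + 1) = a + 1 := by
  rcases le_total 0 a with h | h
  · rw [max_eq_right h, min_eq_left (by linarith)]
  · rw [max_eq_left h, min_eq_right (by linarith)]; ring

theorem unif_circDist_le {x r : ℝ} (hx : x ∈ Set.Icc (0 : ℝ) 1) (hr : 0 ≤ r) :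
    unif {t | circDist x t ≤ r} ≤ ENNReal.ofReal (2 * r) := by
  obtain ⟨hx0, hx1⟩ := hx
  by_cases hr2 : 1 / 2 ≤ r
  · calc unif {t | circDist x t ≤ r} ≤ 1 := prob_le_one
      _ ≤ _ := by rw [ENNReal.one_le_ofReal]; linarith
  push Not at hr2
  -- The arc around `x`, cut at 0 and 1: the middle piece is clipped, and what sticks out reappears
  -- at the opposite end, so the lengths add up to 2r.
  have hsub : {t | circDist x t ≤ r} ∩ Set.Icc (0 : ℝ) 1 ⊆
      Set.Icc (max 0 (x - r)) (min 1 (x + r)) ∪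
        (Set.Icc 0 (max 0 (x + r - 1)) ∪ Set.Icc (min 1 (x - r + 1)) 1) := by
    rintro t ⟨ht, ht0, ht1⟩
    simp only [Set.mem_ofPred_eq, circDist, min_le_iff] at ht
    rcases ht with ht | ht
    · left
      rw [abs_le] at ht
      constructor
      · exact max_le ht0 (by linarith)
      · exact le_min ht1 (by linarith)
    · right
      rcases le_total 0 (x - t) with h | h
      · rw [abs_of_nonneg h] at ht
        exact Or.inl ⟨ht0, le_max_of_le_right (by linarith)⟩
      · rw [abs_of_nonpos h] at ht
        exact Or.inr ⟨min_le_of_right_le (by linarith), ht1⟩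
  have hmeas : MeasurableSet {t | circDist x t ≤ r} := measurableSet_le
    (measurable_circDist.comp (show Measurable fun t : ℝ => (x, t) by fun_prop)) measurable_const
  rw [Measure.restrict_apply hmeas]
  refine (measure_mono hsub).trans ((measure_union_le _ _).trans
    ((add_le_add_right (measure_union_le _ _) _).trans (le_of_eq ?_)))
  rw [Real.volume_Icc, Real.volume_Icc, Real.volume_Icc, ← ENNReal.ofReal_add,
    ← ENNReal.ofReal_add]
  · congr 1
    linarith [min_one_add_max_sub (x + r), max_zero_add_min_add (x - r)]
  · rw [sub_nonneg]
    exact max_le (le_min (by linarith) (by linarith)) (le_min (by linarith) (by linarith))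
  · exact add_nonneg (by simp) (by simp)
  · simp
  · simp

/-- The expected weight of a uniform point that is discounted by `ρ` near both of `x ≤ y`, and
excluded from the interval between them. -/
theorem lintegral_gap_weight_le {x y r ρ : ℝ} (hx : 0 ≤ x) (hxy : x ≤ y) (hy : y ≤ 1)
    (hr : y - x ≤ r) (hr2 : r ≤ 1 / 2) (hρ0 : 0 ≤ ρ) (hρ1 : ρ ≤ 1) (g : ℝ → ENNReal)
    (hg1 : ∀ t, g t ≤ 1) (hg0 : ∀ t, x < t → t < y → g t = 0)
    (hgρ : ∀ t, circDist x t ≤ r → circDist y t ≤ r → g t ≤ ENNReal.ofReal ρ) :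
    ∫⁻ t, g t ∂unif ≤
      ENNReal.ofReal (1 - (y - x) - (1 - ρ) * (2 * (r - (y - x)))) := by
  set w := r - (y - x) with hw
  have hw0 : 0 ≤ w := by linarith
  clear_value w
  -- The points near both `x` and `y` and outside the gap: an arc of length `w` on either side, each
  -- with its wrapped part. The bound `r ≤ 1 / 2` keeps the two arcs disjoint.
  set R : Set ℝ := (Set.Ioc y (min 1 (y + w)) ∪ Set.Ico 0 (max 0 (y + w - 1))) ∪
    (Set.Ico (max 0 (x - w)) x ∪ Set.Ioc (min 1 (x - w + 1)) 1) with hR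
  have hRm : MeasurableSet R := by measurability
  have hAm : MeasurableSet (Set.Ioo x y) := measurableSet_Ioo
  have hRsub : R ⊆ Set.Icc 0 1 := by
    rintro t ((h | h) | (h | h)) <;> simp only [Set.mem_Ioc, Set.mem_Ico, le_min_iff, lt_max_iff,
      max_le_iff, min_lt_iff] at h
    · exact ⟨by linarith, h.2.1⟩
    · exact ⟨h.1, by rcases h.2 with h' | h' <;> linarith⟩
    · exact ⟨h.1.1, by linarith⟩
    · exact ⟨by rcases h.1 with h' | h' <;> linarith, h.2⟩
  have hdisj : ∀ t ∈ R, ¬ (x < t ∧ t < y) := by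
    rintro t ((h | h) | (h | h)) <;> simp only [Set.mem_Ioc, Set.mem_Ico, le_min_iff, lt_max_iff,
      max_le_iff, min_lt_iff] at h
    · exact fun h' => by linarith
    · rintro ⟨h1, h2⟩
      rcases h.2 with h' | h' <;> linarith
    · exact fun h' => by linarith
    · rintro ⟨h1, h2⟩
      rcases h.1 with h' | h' <;> linarith
  have hnear : ∀ t ∈ R, circDist x t ≤ r ∧ circDist y t ≤ r := by
    rintro t ((h | h) | (h | h)) <;> simp only [Set.mem_Ioc, Set.mem_Ico, le_min_iff, lt_max_iff,
      max_le_iff, min_lt_iff] at h <;> simp only [circDist, min_le_iff]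
    · rw [abs_of_nonpos (by linarith), abs_of_nonpos (by linarith)]
      exact ⟨Or.inl (by linarith), Or.inl (by linarith)⟩
    · have h2 : t < y + w - 1 := by rcases h.2 with h' | h' <;> linarith
      rw [abs_of_nonneg (by linarith), abs_of_nonneg (by linarith)]
      exact ⟨Or.inr (by linarith), Or.inr (by linarith)⟩
    · rw [abs_of_nonneg (by linarith), abs_of_nonneg (by linarith)]
      exact ⟨Or.inl (by linarith), Or.inl (by linarith)⟩
    · have h2 : x - w + 1 < t := by rcases h.1 with h' | h' <;> linarith
      rw [abs_of_nonpos (by linarith), abs_of_nonpos (by linarith)]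
      exact ⟨Or.inr (by linarith), Or.inr (by linarith)⟩
  have hvolR : volume R = ENNReal.ofReal (2 * w) := by
    rw [hR, measure_union, measure_union, measure_union, Real.volume_Ioc, Real.volume_Ico,
      Real.volume_Ico, Real.volume_Ioc, ← ENNReal.ofReal_add, ← ENNReal.ofReal_add,
      ← ENNReal.ofReal_add]
    · congr 1
      linarith [min_one_add_max_sub (y + w), max_zero_add_min_add (x - w)]
    · exact add_nonneg (by simp [hw0, hy]) (by simp)
    · exact add_nonneg (by simp [hw0, hx]) (by simp)
    · simp [hw0, hx]
    · simp
    · simp [hw0, hy]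
    · simp
    · rw [Set.disjoint_left]
      intro t h h'
      simp only [Set.mem_Ioc, Set.mem_Ico, max_le_iff, min_lt_iff] at h h'
      rcases h'.1 with h'' | h'' <;> linarith
    · exact measurableSet_Ioc
    · rw [Set.disjoint_left]
      intro t h h'
      simp only [Set.mem_Ioc, Set.mem_Ico, le_min_iff, lt_max_iff] at h h'
      rcases h'.2 with h'' | h'' <;> linarith
    · exact measurableSet_Ico
    · rw [Set.disjoint_left]
      rintro t (h | h) (h' | h') <;> simp only [Set.mem_Ioc, Set.mem_Ico, le_min_iff, lt_max_iff,
        max_le_iff, min_lt_iff] at h h'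
      · linarith
      · rcases h'.1 with h'' | h'' <;> linarith
      · rcases h.2 with h'' | h'' <;> linarith
      · rcases h.2 with h'' | h'' <;> rcases h'.1 with h''' | h''' <;> linarith
    · measurability
  -- Adding the missing mass back to `g` keeps it below 1. Integrating this sum needs no
  -- measurability of `g`.
  have hpt : ∀ t, g t + ((Set.Ioo x y).indicator 1 t +
      ENNReal.ofReal (1 - ρ) * R.indicator 1 t) ≤ 1 := by
    intro t
    by_cases hA : x < t ∧ t < y
    · have hnR : t ∉ R := fun h => hdisj t h hA
      rw [hg0 t hA.1 hA.2, Set.indicator_of_mem (show t ∈ Set.Ioo x y from hA),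
        Set.indicator_of_notMem hnR]
      simp
    · rw [Set.indicator_of_notMem (show t ∉ Set.Ioo x y from hA)]
      by_cases hRt : t ∈ R
      · rw [Set.indicator_of_mem hRt]
        have := hgρ t (hnear t hRt).1 (hnear t hRt).2
        calc _ ≤ ENNReal.ofReal ρ + (0 + ENNReal.ofReal (1 - ρ) * 1) := by gcongr; rfl
          _ = 1 := by
            rw [zero_add, mul_one, ← ENNReal.ofReal_add hρ0 (by linarith)]
            simp
      · rw [Set.indicator_of_notMem hRt]
        simpa using hg1 t
  have hint : ∫⁻ t, g t ∂unif + ENNReal.ofReal ((y - x) + (1 - ρ) * (2 * w)) ≤ 1 := by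
    calc _ = ∫⁻ t, g t ∂unif + (∫⁻ t, (Set.Ioo x y).indicator 1 t ∂unif +
          ENNReal.ofReal (1 - ρ) * ∫⁻ t, R.indicator 1 t ∂unif) := by
          congr 1
          rw [lintegral_indicator_one hAm, lintegral_indicator_one hRm,
            Measure.restrict_eq_self _ hRsub, hvolR, Measure.restrict_eq_self, Real.volume_Ioo,
            ENNReal.ofReal_add, ENNReal.ofReal_mul]
          · linarith
          · linarith
          · exact mul_nonneg (by linarith) (by linarith)
          · exact fun t ht => ⟨by linarith [ht.1], by linarith [ht.2]⟩
      _ = ∫⁻ t, g t + ((Set.Ioo x y).indicator 1 t +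
          ENNReal.ofReal (1 - ρ) * R.indicator 1 t) ∂unif := by
          rw [lintegral_add_right, lintegral_add_left, lintegral_const_mul]
          · exact measurable_one.indicator hRm
          · exact measurable_one.indicator hAm
          · exact (measurable_one.indicator hAm).add
              ((measurable_one.indicator hRm).const_mul _)
      _ ≤ ∫⁻ t, 1 ∂unif := lintegral_mono hpt
      _ = 1 := by simp
  have h0 : 0 ≤ (y - x) + (1 - ρ) * (2 * w) :=
    add_nonneg (by linarith) (mul_nonneg (by linarith) (by linarith))
  rw [sub_sub, ENNReal.ofReal_sub _ h0, ENNReal.ofReal_one]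
  exact ENNReal.le_sub_of_add_le_right ENNReal.ofReal_ne_top hint

end Line

/-! ### Probabilities of bad nodes and pairs, and the link to triangle counts -/

section Events

variable {n : ℕ}

theorem featureLaw_circDist_le {u v : Fin n} (huv : u ≠ v) {r : ℝ} (hr : 0 ≤ r) :
    featureLaw n {X | X u ∈ Set.Icc (0 : ℝ) 1 ∧ circDist (X u) (X v) ≤ r} ≤
      ENNReal.ofReal (2 * r) := by
  have hm : MeasurableSet {z : ℝ × ℝ | circDist z.1 z.2 ≤ r} :=
    measurableSet_le measurable_circDist measurable_const
  have hms : ∀ x, MeasurableSet {t | circDist x t ≤ r} := fun x =>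
    (show Measurable fun t : ℝ => (x, t) by fun_prop) hm
  refine measure_pi_single_le unif u (Set.Icc 0 1) measurableSet_Icc
    (fun i x t => if i = v then {z : ℝ × ℝ | circDist z.1 z.2 ≤ r}.indicator 1 (x, t) else 1)
    (fun i => ?_) _ (fun x hx => ?_) _ (fun X hX => ⟨hX.1, ?_⟩)
  · by_cases h : i = v
    · simp only [h, if_true]
      exact measurable_one.indicator hm
    · simp only [h, if_false]
      exact measurable_const
  · rw [Finset.prod_eq_single v]
    · simp only [if_true]
      refine le_trans (le_of_eq ?_) (unif_circDist_le hx hr)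
      rw [← lintegral_indicator_one (hms x)]
      rfl
    · intro i _ h
      simp [h]
    · intro h
      simp [huv.symm] at h
  · rw [Finset.prod_eq_one]
    intro i _
    by_cases h : i = v
    · subst h
      simp only [if_true]
      rw [Set.indicator_of_mem]
      · rfl
      · exact hX.2
    · simp [h]

theorem prod_le_pow_card {ι : Type*} (s : Finset ι) (p : ι → Prop) [DecidablePred p]
    (f : ι → ENNReal) (q : ENNReal) (h1 : ∀ i, p i → f i ≤ q) (h2 : ∀ i, ¬ p i → f i ≤ 1) :
    ∏ i ∈ s, f i ≤ q ^ (s.filter p).card := by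
  calc ∏ i ∈ s, f i ≤ ∏ i ∈ s, if p i then q else 1 := by
        refine Finset.prod_le_prod' fun i _ => ?_
        split_ifs with h
        · exact h1 i h
        · exact h2 i h
    _ = _ := by simp [Finset.prod_ite]

/-- The probability that no node of the same cluster follows `u` within distance `h`. -/
theorem featureLaw_no_successor_le (σ : Fin n → Bool) (u : Fin n) {h : ℝ} (h0 : 0 ≤ h) :
    featureLaw n {X | X u ∈ Set.Icc 0 (1 - h) ∧
        ∀ z, z ≠ u → σ z = σ u → X z ∉ Set.Ioc (X u) (X u + h)} ≤
      ENNReal.ofReal (1 - h) ^ (({u}ᶜ : Finset (Fin n)).filter fun z => σ z = σ u).card := by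
  have hm : MeasurableSet {z : ℝ × ℝ | z.1 < z.2 ∧ z.2 ≤ z.1 + h}ᶜ :=
    ((measurableSet_lt measurable_fst measurable_snd).inter
      (measurableSet_le measurable_snd (measurable_fst.add_const h))).compl
  refine measure_pi_single_le unif u (Set.Icc 0 (1 - h)) measurableSet_Icc
    (fun i x t => if σ i = σ u then {z : ℝ × ℝ | z.1 < z.2 ∧ z.2 ≤ z.1 + h}ᶜ.indicator 1 (x, t)
      else 1) (fun i => ?_) _ (fun x hx => ?_) _ (fun X hX => ⟨hX.1, ?_⟩)
  · by_cases h : σ i = σ u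
    · simp only [h, if_true]
      exact measurable_one.indicator hm
    · simp only [h, if_false]
      exact measurable_const
  · refine prod_le_pow_card _ _ _ _ (fun i hi => ?_) (fun i hi => ?_)
    · simp only [hi, if_true]
      have e : ∀ t, {z : ℝ × ℝ | z.1 < z.2 ∧ z.2 ≤ z.1 + h}ᶜ.indicator (1 : ℝ × ℝ → ENNReal) (x, t)
          = (Set.Ioc x (x + h))ᶜ.indicator 1 t := fun t => rfl
      simp only [e]
      rw [lintegral_indicator_one measurableSet_Ioc.compl, prob_compl_eq_one_sub measurableSet_Ioc,
        Measure.restrict_eq_self, Real.volume_Ioc, ENNReal.ofReal_sub _ h0, add_sub_cancel_left,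
        ENNReal.ofReal_one]
      intro t ht
      exact ⟨by linarith [hx.1, ht.1], by linarith [hx.2, ht.2]⟩
    · simp [hi]
  · rw [Finset.prod_eq_one]
    intro i hi
    by_cases h : σ i = σ u
    · simp only [h, if_true]
      rw [Set.indicator_of_mem]
      · rfl
      · exact hX.2 i (by simpa using hi) h
    · simp [h]

open Classical in
/-- The number of further nodes of the cluster of `u` that are near both of `u` and `v`. -/
def nearBoth (σ : Fin n → Bool) (X : Fin n → ℝ) (r : ℝ) (u v : Fin n) : ℕ :=
  (({u, v}ᶜ : Finset (Fin n)).filter fun z =>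
    σ z = σ u ∧ circDist (X u) (X z) ≤ r ∧ circDist (X v) (X z) ≤ r).card

/-- The probability that two nodes of a cluster are neighbours on the line at distance at most `h`
and have few common neighbours. -/
theorem featureLaw_sparse_gap_le (σ : Fin n → Bool) {u v : Fin n} (huv : u ≠ v) {r h ρ B T : ℝ}
    (hr : r ≤ 1 / 2) (h0 : 0 ≤ h) (hh : h ≤ r) (hρ0 : 0 < ρ) (hρ1 : ρ ≤ 1)
    (hB : ∀ d, 0 ≤ d → d ≤ h → (1 - d - (1 - ρ) * (2 * (r - d))) ^
      (({u, v}ᶜ : Finset (Fin n)).filter fun z => σ z = σ u).card ≤ B) :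
    ENNReal.ofReal (ρ ^ T) * featureLaw n {X | (∀ i, X i ∈ Set.Icc (0 : ℝ) 1) ∧
        X u ≤ X v ∧ X v ≤ X u + h ∧ (∀ z, σ z = σ u → ¬ (X u < X z ∧ X z < X v)) ∧
        (nearBoth σ X r u v : ℝ) ≤ T} ≤
      ENNReal.ofReal B * ENNReal.ofReal (2 * h) := by
  classical
  set D : Set (ℝ × ℝ) := {z | 0 ≤ z.1 ∧ z.1 ≤ z.2 ∧ z.2 ≤ 1 ∧ z.2 ≤ z.1 + h} with hD
  have hDm : MeasurableSet D :=
    (measurableSet_le measurable_const measurable_fst).inter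
    ((measurableSet_le measurable_fst measurable_snd).inter
    ((measurableSet_le measurable_snd measurable_const).inter
      (measurableSet_le measurable_snd (measurable_fst.add_const h))))
  have hDle : featureLaw n {X | (X u, X v) ∈ D} ≤ ENNReal.ofReal (2 * h) := by
    refine (measure_mono ?_).trans (featureLaw_circDist_le huv h0)
    rintro X ⟨h1, h2, h3, h4⟩
    simp only at h1 h2 h3 h4
    refine ⟨⟨h1, h2.trans h3⟩, ?_⟩
    refine min_le_of_left_le ?_
    rw [abs_of_nonpos (by linarith)]
    linarith
  -- The weight zero encodes the empty gap and `ρ` discounts a common neighbour, so the product over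
  -- the cluster is ρ to the number of common neighbours on the event.
  set g : Fin n → ℝ → ℝ → ℝ → ENNReal := fun i x y t =>
    if σ i = σ u then (if x < t ∧ t < y then 0 else
      if circDist x t ≤ r ∧ circDist y t ≤ r then ENNReal.ofReal ρ else 1) else 1 with hg
  have hgm : ∀ i, Measurable fun z : ℝ × ℝ × ℝ => g i z.1 z.2.1 z.2.2 := by
    intro i
    by_cases hi : σ i = σ u
    · simp only [hg, hi, if_true]
      refine Measurable.ite ?_ measurable_const (Measurable.ite ?_ measurable_const measurable_const)
      · exact (measurableSet_lt measurable_fst (measurable_snd.comp measurable_snd)).inter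
          (measurableSet_lt (measurable_snd.comp measurable_snd)
            (measurable_fst.comp measurable_snd))
      · exact (measurableSet_le (measurable_circDist.comp (show Measurable
          fun z : ℝ × ℝ × ℝ => (z.1, z.2.2) by fun_prop)) measurable_const).inter
          (measurableSet_le (measurable_circDist.comp (show Measurable
          fun z : ℝ × ℝ × ℝ => (z.2.1, z.2.2) by fun_prop)) measurable_const)
    · simp only [hg, hi, if_false]
      exact measurable_const
  have hρ1' : ENNReal.ofReal ρ ≤ 1 := by simpa using hρ1
  refine (measure_pi_pair_le unif u v D hDm g hgm (ENNReal.ofReal B) _ (fun x y hxy => ?_) _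
    (fun X hX => ⟨⟨(hX.1 u).1, hX.2.1, (hX.1 v).2, hX.2.2.1⟩, ?_⟩)).trans
    (mul_le_mul_right hDle _)
  · obtain ⟨h1, h2, h3, h4⟩ := hxy
    simp only at h1 h2 h3 h4
    refine (prod_le_pow_card _ (fun z => σ z = σ u) _
      (ENNReal.ofReal (1 - (y - x) - (1 - ρ) * (2 * (r - (y - x))))) (fun i hi => ?_)
      (fun i hi => ?_)).trans ?_
    · refine lintegral_gap_weight_le h1 h2 h3 (by linarith) hr hρ0.le hρ1 _ (fun t => ?_)
        (fun t ht1 ht2 => ?_) (fun t ht1 ht2 => ?_)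
      · simp only [hg]
        split_ifs <;> simp [hρ1']
      · simp [hg, hi, ht1, ht2]
      · simp only [hg, hi, ht1, ht2]
        split_ifs <;> simp_all
    · simp [hg, hi]
    · rw [← ENNReal.ofReal_pow]
      · exact ENNReal.ofReal_le_ofReal (hB _ (by linarith) (by linarith))
      · nlinarith
  · obtain ⟨hc, h1, h2, h3, h4⟩ := hX
    have hprod : ∏ i ∈ ({u, v}ᶜ : Finset (Fin n)), g i (X u) (X v) (X i) =
        ENNReal.ofReal ρ ^ nearBoth σ X r u v := by
      rw [nearBoth, ← Finset.prod_const, Finset.prod_filter]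
      refine Finset.prod_congr rfl fun i _ => ?_
      by_cases hi : σ i = σ u
      · simp only [hg, hi, h3 i hi, if_true, if_false, true_and]
      · simp [hg, hi]
    rw [hprod, ← ENNReal.ofReal_pow hρ0.le]
    refine ENNReal.ofReal_le_ofReal ?_
    rw [← Real.rpow_natCast]
    exact Real.rpow_le_rpow_of_exponent_ge hρ0 hρ1 h4

open Classical in
/-- The number of further nodes near the one of `u`, `v` that lies in the other cluster. -/
def nearOther (σ : Fin n → Bool) (X : Fin n → ℝ) (r : ℝ) (u v : Fin n) : ℕ :=
  (({u, v}ᶜ : Finset (Fin n)).filter fun z =>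
    circDist (if σ z = σ u then X v else X u) (X z) ≤ r).card

/-- The probability that two nodes are close and that many nodes are near the one in the other
cluster. -/
theorem featureLaw_dense_pair_le (σ : Fin n → Bool) {u v : Fin n} (huv : u ≠ v) {r e T : ℝ}
    (hr : 0 ≤ r) (he : 1 ≤ e) :
    ENNReal.ofReal (e ^ T) * featureLaw n {X | (∀ i, X i ∈ Set.Icc (0 : ℝ) 1) ∧
        circDist (X u) (X v) ≤ r ∧ T ≤ (nearOther σ X r u v : ℝ)} ≤
      ENNReal.ofReal (Real.exp ((e - 1) * (2 * r) * n)) * ENNReal.ofReal (2 * r) := by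
  classical
  set D : Set (ℝ × ℝ) := {z | z.1 ∈ Set.Icc (0 : ℝ) 1 ∧ z.2 ∈ Set.Icc (0 : ℝ) 1 ∧
    circDist z.1 z.2 ≤ r} with hD
  have hDm : MeasurableSet D :=
    (measurable_fst measurableSet_Icc).inter ((measurable_snd measurableSet_Icc).inter
      (measurableSet_le measurable_circDist measurable_const))
  have hDle : featureLaw n {X | (X u, X v) ∈ D} ≤ ENNReal.ofReal (2 * r) := by
    refine (measure_mono ?_).trans (featureLaw_circDist_le huv hr)
    exact fun X hX => ⟨hX.1, hX.2.2⟩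
  have hcm : MeasurableSet {z : ℝ × ℝ | circDist z.1 z.2 ≤ r} :=
    measurableSet_le measurable_circDist measurable_const
  set g : Fin n → ℝ → ℝ → ℝ → ENNReal := fun i x y t =>
    if circDist (if σ i = σ u then y else x) t ≤ r then ENNReal.ofReal e else 1 with hg
  have hgm : ∀ i, Measurable fun z : ℝ × ℝ × ℝ => g i z.1 z.2.1 z.2.2 := by
    intro i
    refine Measurable.ite ?_ measurable_const measurable_const
    by_cases hi : σ i = σ u
    · simp only [hi, if_true]
      exact (show Measurable fun z : ℝ × ℝ × ℝ => (z.2.1, z.2.2) by fun_prop) hcm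
    · simp only [hi, if_false]
      exact (show Measurable fun z : ℝ × ℝ × ℝ => (z.1, z.2.2) by fun_prop) hcm
  have hint : ∀ x ∈ Set.Icc (0 : ℝ) 1, ∫⁻ t, (if circDist x t ≤ r then ENNReal.ofReal e else 1) ∂unif
      ≤ ENNReal.ofReal (Real.exp ((e - 1) * (2 * r))) := by
    intro x hx
    have hms : MeasurableSet {t | circDist x t ≤ r} :=
      (show Measurable fun t : ℝ => (x, t) by fun_prop) hcm
    calc _ ≤ ∫⁻ t, 1 + ENNReal.ofReal (e - 1) * {t | circDist x t ≤ r}.indicator 1 t ∂unif := by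
          refine lintegral_mono fun t => ?_
          by_cases ht : circDist x t ≤ r
          · simp only [ht, if_true]
            rw [Set.indicator_of_mem (show t ∈ {t | circDist x t ≤ r} from ht), Pi.one_apply,
              mul_one, ← ENNReal.ofReal_one, ← ENNReal.ofReal_add (by norm_num) (by linarith)]
            simp
          · simp [ht]
      _ = 1 + ENNReal.ofReal (e - 1) * unif {t | circDist x t ≤ r} := by
          rw [lintegral_add_left measurable_const, lintegral_const_mul _ (measurable_one.indicator hms),
            lintegral_indicator_one hms]
          simp
      _ ≤ 1 + ENNReal.ofReal (e - 1) * ENNReal.ofReal (2 * r) := by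
          gcongr
          exact unif_circDist_le hx hr
      _ = ENNReal.ofReal (1 + (e - 1) * (2 * r)) := by
          rw [← ENNReal.ofReal_mul (by linarith), ENNReal.ofReal_add (by norm_num)
            (mul_nonneg (by linarith) (by linarith)), ENNReal.ofReal_one]
      _ ≤ _ := ENNReal.ofReal_le_ofReal (by
          rw [add_comm]
          exact Real.add_one_le_exp _)
  refine (measure_pi_pair_le unif u v D hDm g hgm _ _ (fun x y hxy => ?_) _
    (fun X hX => ⟨⟨hX.1 u, hX.1 v, hX.2.1⟩, ?_⟩)).trans (mul_le_mul_right hDle _)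
  · calc _ ≤ ∏ i ∈ ({u, v}ᶜ : Finset (Fin n)),
          ENNReal.ofReal (Real.exp ((e - 1) * (2 * r))) := by
          refine Finset.prod_le_prod' fun i _ => hint _ ?_
          split_ifs
          · exact hxy.2.1
          · exact hxy.1
      _ ≤ ENNReal.ofReal (Real.exp ((e - 1) * (2 * r))) ^ n := by
          rw [Finset.prod_const]
          refine pow_le_pow_right₀ ?_ ((Finset.card_le_univ _).trans (by simp))
          rw [ENNReal.one_le_ofReal, Real.one_le_exp_iff]
          exact mul_nonneg (by linarith) (by linarith)
      _ = _ := by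
          rw [← ENNReal.ofReal_pow (Real.exp_nonneg _), ← Real.exp_nat_mul, mul_comm (n : ℝ)]
  · obtain ⟨_, _, h3⟩ := hX
    have hprod : ∏ i ∈ ({u, v}ᶜ : Finset (Fin n)), g i (X u) (X v) (X i) =
        ENNReal.ofReal e ^ nearOther σ X r u v := by
      rw [nearOther, ← Finset.prod_const, Finset.prod_filter]
    rw [hprod, ← ENNReal.ofReal_pow (by linarith)]
    refine ENNReal.ofReal_le_ofReal ?_
    rw [← Real.rpow_natCast]
    exact Real.rpow_le_rpow_of_exponent_le he h3

theorem nearBoth_le_triangleCount (θ₁ θ₂ : ℝ) (σ : Fin n → Bool) (X : Fin n → ℝ) {u v : Fin n}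
    (hs : σ u = σ v) :
    nearBoth σ X (θ₁ * (Real.log n / n)) u v ≤ triangleCount (graph θ₁ θ₂ σ X) u v := by
  classical
  rw [triangleCount, nearBoth, ← Set.ncard_coe_finset]
  refine Set.ncard_le_ncard (fun z hz => ?_) (Set.toFinite _)
  simp only [Finset.coe_filter, Finset.mem_compl, Finset.mem_insert, Finset.mem_singleton,
    Set.mem_ofPred_eq, not_or] at hz
  obtain ⟨⟨h1, h2⟩, h3, h4, h5⟩ := hz
  refine ⟨⟨Ne.symm h1, ?_⟩, ⟨Ne.symm h2, ?_⟩⟩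
  · rwa [if_pos h3.symm]
  · rwa [if_pos (hs.symm.trans h3.symm)]

/-- With two clusters, `z` differs in label from exactly one of `u`, `v`, and adjacency to that node
uses the small radius. -/
theorem triangleCount_le_nearOther (θ₁ θ₂ : ℝ) (σ : Fin n → Bool) (X : Fin n → ℝ) {u v : Fin n}
    (hs : σ u ≠ σ v) :
    triangleCount (graph θ₁ θ₂ σ X) u v ≤ nearOther σ X (θ₂ * (Real.log n / n)) u v := by
  classical
  rw [triangleCount, nearOther, ← Set.ncard_coe_finset]
  refine Set.ncard_le_ncard (fun z hz => ?_) (Set.toFinite _)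
  obtain ⟨⟨h1, h2⟩, ⟨h3, h4⟩⟩ := hz
  simp only [Finset.coe_filter, Finset.mem_compl, Finset.mem_insert, Finset.mem_singleton,
    Set.mem_ofPred_eq, not_or]
  refine ⟨⟨Ne.symm h1, Ne.symm h3⟩, ?_⟩
  by_cases hz : σ z = σ u
  · rw [if_pos hz]
    rwa [if_neg (fun h => hs (h.trans hz).symm)] at h4
  · rw [if_neg hz]
    rwa [if_neg (Ne.symm hz)] at h2

/-- Each node reaches the greatest node of its cluster through pairs of neighbours on the line. -/
theorem clusterConnected_of_neighbours (H : SimpleGraph (Fin n)) (σ : Fin n → Bool)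
    (X : Fin n → ℝ)
    (hadj : ∀ u v, u ≠ v → σ u = σ v → X u ≤ X v →
      (∀ z, σ z = σ u → ¬ (X u < X z ∧ X z < X v)) → H.Adj u v) :
    ClusterConnected H σ := by
  classical
  -- Induction on the number of nodes strictly to the right of `u`. Ties cause no trouble, since
  -- nothing lies strictly between equal coordinates.
  have key : ∀ k : ℕ, ∀ u w, σ u = σ w → X u ≤ X w →
      (Finset.univ.filter fun z => X u < X z).card ≤ k → (monoPart H σ).Reachable u w := by
    intro k
    induction k with
    | zero =>
      intro u w hs hle hk
      by_cases huw : u = w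
      · rw [huw]
      · refine SimpleGraph.Adj.reachable ⟨hadj u w huw hs hle fun z _ hz => ?_, hs⟩
        simp only [Nat.le_zero, Finset.card_eq_zero] at hk
        have : z ∈ (Finset.univ.filter fun z => X u < X z) := by simp [hz.1]
        simp [hk] at this
    | succ k ih =>
      intro u w hs hle hk
      by_cases huw : u = w
      · rw [huw]
      rcases (Finset.univ.filter fun z => σ z = σ u ∧ X u < X z ∧ X z < X w).eq_empty_or_nonempty
        with h0 | hne
      · refine SimpleGraph.Adj.reachable ⟨hadj u w huw hs hle fun z hz hz' => ?_, hs⟩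
        have : z ∈ (Finset.univ.filter fun z => σ z = σ u ∧ X u < X z ∧ X z < X w) := by
          simp [hz, hz']
        simp [h0] at this
      · obtain ⟨v, hv, hmin⟩ := Finset.exists_min_image _ X hne
        simp only [Finset.mem_filter, Finset.mem_univ, true_and] at hv hmin
        obtain ⟨hv1, hv2, hv3⟩ := hv
        have huv : (monoPart H σ).Adj u v := by
          refine ⟨hadj u v (fun h => by simp [h] at hv2) hv1.symm hv2.le fun z hz hz' => ?_, hv1.symm⟩
          exact absurd (hmin z ⟨hz, hz'.1, hz'.2.trans hv3⟩) (not_le.2 hz'.2)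
        refine huv.reachable.trans (ih v w (hv1.trans hs) hv3.le ?_)
        have : (Finset.univ.filter fun z => X v < X z).card <
            (Finset.univ.filter fun z => X u < X z).card := by
          refine Finset.card_lt_card ⟨fun z hz => ?_, fun hsub => ?_⟩
          · simp only [Finset.mem_filter, Finset.mem_univ, true_and] at hz ⊢
            exact hv2.trans hz
          · have := hsub (show v ∈ _ by simp [hv2])
            simp at this
        omega
  intro u v hs
  rcases le_total (X u) (X v) with h | h
  · exact key _ u v hs h le_rfl
  · exact (key _ v u hs.symm h le_rfl).symm

/-- Without exceptional nodes and pairs, Phase 1 keeps the clusters connected. -/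
theorem clusterConnected_phase1 {θ₁ θ₂ : ℝ} {σ : Fin n → Bool} {X : Fin n → ℝ} {E h : ℝ}
    (hθ : h ≤ θ₁ * (Real.log n / n)) (hX : ∀ i, X i ∈ Set.Icc (0 : ℝ) 1)
    (h1 : ∀ u, ¬ (X u ∈ Set.Icc 0 (1 - h) ∧
        ∀ z, z ≠ u → σ z = σ u → X z ∉ Set.Ioc (X u) (X u + h)))
    (h2 : ∀ u v, u ≠ v → σ u = σ v → ¬ ((∀ i, X i ∈ Set.Icc (0 : ℝ) 1) ∧
        X u ≤ X v ∧ X v ≤ X u + h ∧ (∀ z, σ z = σ u → ¬ (X u < X z ∧ X z < X v)) ∧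
        (nearBoth σ X (θ₁ * (Real.log n / n)) u v : ℝ) ≤ n * E)) :
    ClusterConnected (phase1 (graph θ₁ θ₂ σ X) E) σ := by
  refine clusterConnected_of_neighbours _ σ X fun u v huv hs hle hgap => ?_
  have hh : X v ≤ X u + h := by
    by_cases hu : X u ∈ Set.Icc 0 (1 - h)
    · have := h1 u
      push Not at this
      obtain ⟨z, hzu, hzs, hz1, hz2⟩ := this hu
      by_contra hlt
      exact hgap z hzs ⟨hz1, by linarith⟩
    -- Near the right end no successor is needed: `X v ≤ 1` already bounds the distance, so wrapping
    -- around the circle plays no role.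
    · have : 1 - h < X u := by
        by_contra hlt
        exact hu ⟨(hX u).1, by linarith⟩
      linarith [(hX v).2]
  refine ⟨⟨huv, ?_⟩, fun hle' => h2 u v huv hs ⟨hX, hle, hh, hgap, ?_⟩⟩
  · rw [if_pos hs]
    refine min_le_of_left_le ?_
    rw [abs_of_nonpos (by linarith)]
    linarith
  · rw [Nat.card_fin] at hle'
    exact le_trans (Nat.cast_le.2 (nearBoth_le_triangleCount θ₁ θ₂ σ X hs)) hle'

end Events

/-! ### The exponents obtained from `η` and `t₁` -/

section Parameters

/-- The function is continuous, because x log x is, so the strict inequality that defines the set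
passes to its infimum as a weak one. -/
theorem two_le_at_η {θ₁ : ℝ} (hθ₁ : 2 ≤ θ₁) :
    2 ≤ (2 * θ₁ - 2 - η θ₁) * Real.log ((2 * θ₁ - 2 - η θ₁) / (2 * θ₁ - 2)) + η θ₁ := by
  set b := 2 * θ₁ - 2 with hb
  have hb2 : 2 ≤ b := by linarith
  set S : Set ℝ := {t : ℝ | 0 ≤ t ∧ (b - t) * Real.log ((b - t) / b) + t > 2} with hS
  have hne : S.Nonempty := by
    -- Beyond `b` the logarithm is taken at a negative argument, where `Real.log` uses the absolute
    -- value. This point shows the set nonempty even for θ₁ = 2.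
    refine ⟨b + 1, by linarith, ?_⟩
    have e : (b - (b + 1)) / b = -(b⁻¹) := by field_simp; ring
    rw [e, Real.log_neg_eq_log, Real.log_inv]
    have : 0 < Real.log b := Real.log_pos (by linarith)
    linarith
  have hmem : η θ₁ ∈ closure S := csInf_mem_closure hne ⟨0, fun t ht => ht.1⟩
  have hcont : Continuous fun t : ℝ => (b - t) * Real.log ((b - t) / b) + t := by
    have e : (fun t : ℝ => (b - t) * Real.log ((b - t) / b) + t) =
        fun t => b * ((b - t) / b * Real.log ((b - t) / b)) + t := by
      funext t
      field_simp
    rw [e]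
    have := Real.continuous_mul_log.comp (show Continuous fun t : ℝ => (b - t) / b by fun_prop)
    exact (continuous_const.mul this).add continuous_id
  have hsub : closure S ⊆ {t | 2 ≤ (b - t) * Real.log ((b - t) / b) + t} :=
    closure_minimal (fun t ht => ht.2.le) (isClosed_le continuous_const hcont)
  exact hsub hmem

theorem η_nonneg (θ₁ : ℝ) : 0 ≤ η θ₁ := Real.sInf_nonneg fun _ ht => ht.1

theorem t₁_nonneg (θ₂ : ℝ) : 0 ≤ t₁ θ₂ := Real.sInf_nonneg fun _ ht => ht.1

/-- The rates for the clusters: `ρ` is the discount of the Chernoff bound, and gaps up to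
`c log n / n` are bridged. -/
theorem exists_rates {θ₁ : ℝ} (hθ₁ : 2 ≤ θ₁) (hτ : 0 < τ θ₁) :
    ∃ ρ c κ : ℝ, 0 < ρ ∧ ρ < 1 ∧ 2 < c ∧ c ≤ θ₁ ∧ 0 < κ ∧
      ∀ d, 0 ≤ d → d ≤ c →
        1 + κ ≤ d / 2 + (1 - ρ) * (θ₁ - d) + τ θ₁ * Real.log ρ := by
  have h2 := two_le_at_η hθ₁
  have h0 := η_nonneg θ₁
  have hηeq : η θ₁ = 2 * θ₁ - 2 - 2 * τ θ₁ := by unfold τ; ring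
  have hb : 0 < θ₁ - 1 := by linarith
  have hlog : (2 * θ₁ - 2 - η θ₁) / (2 * θ₁ - 2) = τ θ₁ / (θ₁ - 1) := by
    rw [hηeq, show 2 * θ₁ - 2 = 2 * (θ₁ - 1) by ring]
    field_simp
    ring
  set ρ := τ θ₁ / (θ₁ - 1) with hρ
  have hτρ : τ θ₁ = ρ * (θ₁ - 1) := by rw [hρ]; field_simp
  have hρ0 : 0 < ρ := div_pos hτ hb
  rw [hlog] at h2
  have hη0 : η θ₁ ≠ 0 := by
    intro h
    have h1 : ρ = 1 := by
      rw [← hlog, h, sub_zero, div_self (by linarith)]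
    rw [h1, h, Real.log_one] at h2
    norm_num at h2
  have hηpos : 0 < η θ₁ := lt_of_le_of_ne h0 (Ne.symm hη0)
  have hρ1 : ρ < 1 := by
    rw [hρ, div_lt_one hb]
    linarith
  have hlog0 : Real.log ρ < 0 := Real.log_neg hρ0 hρ1
  -- The logarithmic term is negative, so η > 2, while τ > 0 says η < 2θ₁ - 2.
  have hθ₁' : 2 < θ₁ := by
    have : (2 * θ₁ - 2 - η θ₁) * Real.log ρ < 0 :=
      mul_neg_of_pos_of_neg (by linarith) hlog0
    linarith
  have hI : 1 - (1 - ρ) * (θ₁ - 1) ≤ τ θ₁ * Real.log ρ := by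
    have e : (2 * θ₁ - 2 - η θ₁) = 2 * τ θ₁ := by linarith
    rw [e] at h2
    nlinarith
  -- By `hI` the slack over 1 is at least (1-ρ) + d(ρ - 1/2), affine in d: it is 1-ρ at d = 0 and
  -- ρ/2 + ρ² at d = 2+ρ, so κ lies below both.
  refine ⟨ρ, 2 + min (θ₁ - 2) ρ, min (1 - ρ) (ρ / 2), hρ0, hρ1, ?_, ?_, ?_, fun d hd0 hd => ?_⟩
  · have : 0 < min (θ₁ - 2) ρ := lt_min (by linarith) hρ0
    linarith
  · linarith [min_le_left (θ₁ - 2) ρ]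
  · exact lt_min (by linarith) (by linarith)
  · have hd' : d ≤ 2 + ρ := by linarith [min_le_right (θ₁ - 2) ρ]
    have key : min (1 - ρ) (ρ / 2) ≤ (1 - ρ) + d * (ρ - 1 / 2) := by
      rcases le_total (1 / 2) ρ with h | h
      · exact (min_le_left _ _).trans (by nlinarith)
      · exact (min_le_right _ _).trans (by nlinarith)
    nlinarith

/-- With a = 2θ₂, the rate x log(x/a) - (x-a) increases for x ≥ a. It exceeds 1 at some a + t below
τ, and ε is its value at τ. Monotonicity comes from log y ≥ 1 - 1/y at y = τ/(a+t). -/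
theorem one_lt_ε {θ₁ θ₂ : ℝ} (hθ₂ : 0 < θ₂) (h : t₁ θ₂ < gap θ₁ θ₂) : 1 < ε θ₁ θ₂ := by
  set a := 2 * θ₂ with ha
  have ha0 : 0 < a := by linarith
  have hne : {t : ℝ | 0 ≤ t ∧ (a + t) * Real.log ((a + t) / a) - t > 1}.Nonempty := by
    have hexp : 1 ≤ Real.exp (2 + 1 / a) := Real.one_le_exp (by positivity)
    refine ⟨a * (Real.exp (2 + 1 / a) - 1), mul_nonneg ha0.le (by linarith), ?_⟩
    have e : a + a * (Real.exp (2 + 1 / a) - 1) = a * Real.exp (2 + 1 / a) := by ring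
    rw [e, mul_div_cancel_left₀ _ ha0.ne', Real.log_exp]
    have : a * Real.exp (2 + 1 / a) * (2 + 1 / a) =
        2 * a * Real.exp (2 + 1 / a) + Real.exp (2 + 1 / a) := by
      field_simp
    nlinarith
  obtain ⟨t, ⟨ht0, ht1⟩, ht⟩ := exists_lt_of_csInf_lt hne h
  have hτ : τ θ₁ = a + gap θ₁ θ₂ := by unfold gap; ring
  have hx : 0 < a + t := by linarith
  have hy : 0 < τ θ₁ := by linarith
  have h1 : Real.log (τ θ₁ / a) = Real.log (τ θ₁ / (a + t)) + Real.log ((a + t) / a) := by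
    rw [← Real.log_mul (by positivity) (by positivity)]
    congr 1
    field_simp
  have h2 : 0 ≤ Real.log ((a + t) / a) := Real.log_nonneg (by rw [one_le_div ha0]; linarith)
  have h3 : 1 - (τ θ₁ / (a + t))⁻¹ ≤ Real.log (τ θ₁ / (a + t)) :=
    Real.one_sub_inv_le_log_of_pos (by positivity)
  have h4 : τ θ₁ * (1 - (τ θ₁ / (a + t))⁻¹) = τ θ₁ - (a + t) := by
    field_simp
  have h5 : τ θ₁ - (a + t) ≤ τ θ₁ * Real.log (τ θ₁ / (a + t)) := by
    rw [← h4]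
    gcongr
  unfold ε
  rw [← ha, h1, mul_add]
  have h6 : (a + t) * Real.log ((a + t) / a) ≤ τ θ₁ * Real.log ((a + t) / a) :=
    mul_le_mul_of_nonneg_right (by linarith) h2
  linarith

end Parameters

/-! ### Union bound for connectivity and Markov bound for cross edges -/

section Bounds

theorem le_ofReal_of_mul_le {a b c : ℝ} {x : ENNReal} (ha : 0 < a) (hb : 0 ≤ b)
    (h : ENNReal.ofReal a * x ≤ ENNReal.ofReal b * ENNReal.ofReal c) :
    x ≤ ENNReal.ofReal (b * c / a) := by
  rw [ENNReal.ofReal_div_of_pos ha, ENNReal.ofReal_mul hb,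
    ENNReal.le_div_iff_mul_le (Or.inl (by simpa using ha)) (Or.inl ENNReal.ofReal_ne_top), mul_comm]
  exact h

theorem featureLaw_compl_cube (n : ℕ) :
    featureLaw n {X | ¬ ∀ i, X i ∈ Set.Icc (0 : ℝ) 1} = 0 := by
  have h : {X : Fin n → ℝ | ¬ ∀ i, X i ∈ Set.Icc (0 : ℝ) 1} =
      ⋃ i, Function.eval i ⁻¹' (Set.Icc (0 : ℝ) 1)ᶜ := by
    ext X
    simp only [Set.mem_ofPred_eq, Set.mem_iUnion, Set.mem_preimage, Set.mem_compl_iff, not_forall]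
  rw [h, measure_iUnion_null_iff]
  intro i
  rw [featureLaw, (measurePreserving_eval (fun _ : Fin n => unif) i).measure_preimage
    measurableSet_Icc.compl.nullMeasurableSet]
  rw [Measure.restrict_apply measurableSet_Icc.compl]
  simp

theorem Balanced.ncard_eq {m : ℕ} {σ : Fin (2 * m) → Bool} (h : Balanced σ) (b : Bool) :
    {x | σ x = b}.ncard = m := by
  have hu : {x | σ x = true}.ncard + {x | σ x = false}.ncard = 2 * m := by
    rw [← Set.ncard_union_eq]
    · have : {x | σ x = true} ∪ {x | σ x = false} = Set.univ := by
        ext x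
        simp
      rw [this, Set.ncard_univ, Nat.card_fin]
    · rw [Set.disjoint_left]
      intro x hx hx'
      simp_all
  unfold Balanced at h
  cases b <;> omega

theorem Balanced.surjective {m : ℕ} (hm : 0 < m) {σ : Fin (2 * m) → Bool} (h : Balanced σ) :
    Function.Surjective σ := by
  intro b
  have := h.ncard_eq b
  obtain ⟨x, hx⟩ := Set.nonempty_of_ncard_ne_zero (s := {x | σ x = b}) (by omega)
  exact ⟨x, hx⟩

theorem Balanced.le_card_filter {m : ℕ} {σ : Fin (2 * m) → Bool} (h : Balanced σ) (b : Bool)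
    (s : Finset (Fin (2 * m))) :
    (m : ℝ) - s.card ≤ ((sᶜ.filter fun z => σ z = b).card : ℝ) := by
  have h1 : (Finset.univ.filter fun z => σ z = b).card = m := by
    have := h.ncard_eq b
    rwa [Set.ncard_eq_toFinset_card', Set.toFinset_ofPred] at this
  have h2 := Finset.le_card_sdiff s (Finset.univ.filter fun z => σ z = b)
  have h3 : (Finset.univ.filter fun z => σ z = b) \ s = sᶜ.filter fun z => σ z = b := by
    ext z
    simp [and_comm]
  rw [h3, h1] at h2
  have : m ≤ s.card + (sᶜ.filter fun z => σ z = b).card := by omega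
  have : (m : ℝ) ≤ s.card + (sᶜ.filter fun z => σ z = b).card := by exact_mod_cast this
  linarith

/-- The failure probability for the connectivity of the clusters. -/
def disconnectBound (θ₁ c κ n : ℝ) : ℝ :=
  Real.exp c * n ^ (1 - c / 2) + Real.exp (4 * θ₁) * (2 * c) * (n ^ (-κ) * Real.log n)

theorem tendsto_disconnectBound {θ₁ c κ : ℝ} (hc : 2 < c) (hκ : 0 < κ) :
    Tendsto (disconnectBound θ₁ c κ) atTop (𝓝 0) := by
  have h1 : Tendsto (fun n : ℝ => n ^ (1 - c / 2)) atTop (𝓝 0) := by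
    have := tendsto_rpow_neg_atTop (show 0 < c / 2 - 1 by linarith)
    simpa using this
  have h2 : Tendsto (fun n : ℝ => n ^ (-κ) * Real.log n) atTop (𝓝 0) := by
    have := (isLittleO_log_rpow_atTop hκ).tendsto_div_nhds_zero
    refine this.congr' ?_
    filter_upwards [eventually_gt_atTop 0] with n hn
    rw [Real.rpow_neg hn.le, div_eq_inv_mul]
  have := (h1.const_mul (Real.exp c)).add (h2.const_mul (Real.exp (4 * θ₁) * (2 * c)))
  rw [mul_zero, mul_zero, add_zero] at this
  exact this

theorem featureLaw_disconnected_le {θ₁ θ₂ ρ c κ : ℝ} (hρ0 : 0 < ρ) (hρ1 : ρ < 1)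
    (hc : 2 < c) (hcθ : c ≤ θ₁)
    (hrate : ∀ d, 0 ≤ d → d ≤ c →
      1 + κ ≤ d / 2 + (1 - ρ) * (θ₁ - d) + τ θ₁ * Real.log ρ)
    {m : ℕ} (hm : 2 ≤ m)
    (hL : θ₁ * (Real.log ((2 * m : ℕ) : ℝ) / ((2 * m : ℕ) : ℝ)) ≤ 1 / 2)
    {σ : Fin (2 * m) → Bool} (hσ : Balanced σ) :
    featureLaw (2 * m) {X | ¬ ClusterConnected
      (phase1 (graph θ₁ θ₂ σ X) (threshold θ₁ (2 * m))) σ} ≤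
      ENNReal.ofReal (disconnectBound θ₁ c κ ((2 * m : ℕ) : ℝ)) := by
  set n : ℝ := ((2 * m : ℕ) : ℝ) with hn
  have hn2 : n = 2 * m := by rw [hn]; push_cast; ring
  have hm' : (2 : ℝ) ≤ m := by exact_mod_cast hm
  have hn4 : 4 ≤ n := by linarith
  have hn0 : 0 < n := by linarith
  set l := Real.log n with hl
  have hl0 : 0 < l := Real.log_pos (by linarith)
  set L := l / n with hLdef
  have hL0 : 0 < L := div_pos hl0 hn0
  have hnL : n * L = l := by rw [hLdef]; field_simp
  have hL1 : L ≤ 1 := by nlinarith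
  have hpow : ∀ x : ℝ, n ^ x = Real.exp (l * x) := fun x => Real.rpow_def_of_pos hn0 x
  have hT : ((2 * m : ℕ) : ℝ) * threshold θ₁ (2 * m) = τ θ₁ * l := by
    rw [threshold, ← hn, ← hl, ← hLdef]
    rw [← hnL]; ring
  set h := c * L with hh
  have hh0 : 0 ≤ h := by positivity
  have hhr : h ≤ θ₁ * L := mul_le_mul_of_nonneg_right hcθ hL0.le
  set A : Fin (2 * m) → Set (Fin (2 * m) → ℝ) := fun u => {X | X u ∈ Set.Icc 0 (1 - h) ∧
    ∀ z, z ≠ u → σ z = σ u → X z ∉ Set.Ioc (X u) (X u + h)} with hA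
  set A2 : Fin (2 * m) × Fin (2 * m) → Set (Fin (2 * m) → ℝ) := fun e =>
    {X | e.1 ≠ e.2 ∧ σ e.1 = σ e.2 ∧ ((∀ i, X i ∈ Set.Icc (0 : ℝ) 1) ∧
        X e.1 ≤ X e.2 ∧ X e.2 ≤ X e.1 + h ∧ (∀ z, σ z = σ e.1 → ¬ (X e.1 < X z ∧ X z < X e.2)) ∧
        (nearBoth σ X (θ₁ * L) e.1 e.2 : ℝ) ≤ τ θ₁ * l)} with hA2
  have hsub : {X | ¬ ClusterConnected (phase1 (graph θ₁ θ₂ σ X) (threshold θ₁ (2 * m))) σ} ⊆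
      {X | ¬ ∀ i, X i ∈ Set.Icc (0 : ℝ) 1} ∪ ((⋃ u, A u) ∪ ⋃ e, A2 e) := by
    intro X hX
    by_contra hnot
    simp only [Set.mem_union, Set.mem_iUnion, not_or, not_exists, Set.mem_ofPred_eq,
      not_not] at hnot
    obtain ⟨hcube, h1, h2⟩ := hnot
    refine hX (clusterConnected_phase1 (h := h) hhr hcube h1 fun u v huv hs hbad => ?_)
    refine h2 (u, v) ⟨huv, hs, ?_⟩
    rw [hT] at hbad
    exact hbad
  have hA1 : ∀ u, featureLaw (2 * m) (A u) ≤ ENNReal.ofReal (Real.exp c * n ^ (-(c / 2))) := by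
    intro u
    refine (featureLaw_no_successor_le σ u hh0).trans ?_
    have hcard := hσ.le_card_filter (σ u) {u}
    rw [Finset.card_singleton, Nat.cast_one] at hcard
    set k := (({u}ᶜ : Finset (Fin (2 * m))).filter fun z => σ z = σ u).card with hk
    calc ENNReal.ofReal (1 - h) ^ k ≤ ENNReal.ofReal (Real.exp (-h)) ^ k := by
          gcongr
          linarith [Real.add_one_le_exp (-h)]
      _ = ENNReal.ofReal (Real.exp (k * (-h))) := by
          rw [← ENNReal.ofReal_pow (Real.exp_nonneg _), Real.exp_nat_mul]
      _ ≤ _ := by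
          refine ENNReal.ofReal_le_ofReal ?_
          rw [hpow, ← Real.exp_add]
          refine Real.exp_le_exp.2 ?_
          have h1 : ((m : ℝ) - 1) * h ≤ k * h := mul_le_mul_of_nonneg_right hcard hh0
          have h2 : (m : ℝ) * h = l * (c / 2) := by
            rw [hh, ← hnL, hn2]; ring
          have h3 : h ≤ c := by nlinarith
          linarith
  have hA2' : ∀ e, featureLaw (2 * m) (A2 e) ≤
      ENNReal.ofReal (Real.exp (4 * θ₁) * n ^ (-(1 + κ)) * (2 * h)) := by
    rintro ⟨u, v⟩
    by_cases huv : u ≠ v ∧ σ u = σ v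
    swap
    · have : A2 (u, v) = ∅ := Set.eq_empty_of_forall_notMem fun X hX => huv ⟨hX.1, hX.2.1⟩
      rw [this, measure_empty]
      exact zero_le
    -- The factor ρ^{τ log n} in `B` is the price of the Chernoff bound and cancels against its left
    -- side.
    have hB := featureLaw_sparse_gap_le σ huv.1 (r := θ₁ * L) (h := h) (ρ := ρ)
      (B := Real.exp (4 * θ₁) * n ^ (-(1 + κ)) * ρ ^ (τ θ₁ * l)) (T := τ θ₁ * l)
      hL hh0 hhr hρ0 hρ1.le ?_
    · refine (measure_mono ?_).trans ((le_ofReal_of_mul_le (Real.rpow_pos_of_pos hρ0 _) (by positivity)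
        hB).trans (le_of_eq ?_))
      · exact fun X hX => hX.2.2
      · congr 1
        have := (Real.rpow_pos_of_pos hρ0 (τ θ₁ * l)).ne'
        field_simp
    · intro d hd0 hd
      have hcard := hσ.le_card_filter (σ u) {u, v}
      rw [Finset.card_pair huv.1, Nat.cast_ofNat] at hcard
      set k := (({u, v}ᶜ : Finset (Fin (2 * m))).filter fun z => σ z = σ u).card with hk
      obtain ⟨g, rfl⟩ : ∃ g, d = g * L := ⟨d / L, by field_simp⟩
      have hg0 : 0 ≤ g := nonneg_of_mul_nonneg_left hd0 hL0
      have hgc : g ≤ c := le_of_mul_le_mul_right hd hL0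
      set W := g + (1 - ρ) * (2 * (θ₁ - g)) with hW
      have hq0 : 0 ≤ 1 - g * L - (1 - ρ) * (2 * (θ₁ * L - g * L)) := by nlinarith
      have hW0 : 0 ≤ W := add_nonneg hg0 (mul_nonneg (by linarith) (by linarith))
      have hWθ : W ≤ 2 * θ₁ := by nlinarith
      calc (1 - g * L - (1 - ρ) * (2 * (θ₁ * L - g * L))) ^ k
          ≤ Real.exp (-(W * L)) ^ k := by
            refine pow_le_pow_left₀ hq0 ?_ k
            have := Real.add_one_le_exp (-(W * L))
            refine le_trans (le_of_eq ?_) this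
            rw [hW]; ring
        _ = Real.exp (k * (-(W * L))) := (Real.exp_nat_mul _ _).symm
        _ ≤ Real.exp (4 * θ₁ + l * (-(1 + κ)) + Real.log ρ * (τ θ₁ * l)) := by
            refine Real.exp_le_exp.2 ?_
            -- Leaving out `u` and `v` loses two factors, each at most exp(2θ₁); this is the
            -- constant exp(4θ₁).
            have h1 : ((m : ℝ) - 2) * (W * L) ≤ k * (W * L) :=
              mul_le_mul_of_nonneg_right hcard (by positivity)
            have h2 : (m : ℝ) * (W * L) = W / 2 * l := by rw [← hnL, hn2]; ring
            have h3 : W * L ≤ 2 * θ₁ := by nlinarith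
            have h4 := mul_le_mul_of_nonneg_right (hrate g hg0 hgc) hl0.le
            have h5 : W / 2 * l = (g / 2 + (1 - ρ) * (θ₁ - g)) * l := by rw [hW]; ring
            nlinarith
        _ = _ := by
            rw [Real.exp_add, Real.exp_add, hpow, Real.rpow_def_of_pos hρ0]
  calc _ ≤ _ := measure_mono hsub
    _ ≤ 0 + (∑ u, featureLaw (2 * m) (A u) + ∑ e, featureLaw (2 * m) (A2 e)) := by
        refine (measure_union_le _ _).trans (add_le_add (featureLaw_compl_cube _).le
          ((measure_union_le _ _).trans (add_le_add ?_ ?_)))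
        · exact measure_iUnion_fintype_le _ _
        · exact measure_iUnion_fintype_le _ _
    _ ≤ 0 + (∑ _u : Fin (2 * m), ENNReal.ofReal (Real.exp c * n ^ (-(c / 2))) +
          ∑ _e : Fin (2 * m) × Fin (2 * m),
            ENNReal.ofReal (Real.exp (4 * θ₁) * n ^ (-(1 + κ)) * (2 * h))) := by
        gcongr with u _ e _
        · exact hA1 u
        · exact hA2' e
    _ = _ := by
        rw [zero_add, Finset.sum_const, Finset.sum_const, Finset.card_univ, Finset.card_univ,
          Fintype.card_prod, Fintype.card_fin, nsmul_eq_mul, nsmul_eq_mul,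
          ← ENNReal.ofReal_natCast, ← ENNReal.ofReal_natCast, ← ENNReal.ofReal_mul (by positivity),
          ← ENNReal.ofReal_mul (by positivity), ← ENNReal.ofReal_add (by positivity)
          (by positivity)]
        congr 1
        rw [disconnectBound, Nat.cast_mul (2 * m), ← hn, ← hl]
        have e1 : n ^ (1 - c / 2) = n * n ^ (-(c / 2)) := by
          rw [sub_eq_add_neg, Real.rpow_add hn0, Real.rpow_one]
        have e2 : n ^ (-κ) = n * n ^ (-(1 + κ)) := by
          rw [show -κ = 1 + -(1 + κ) by ring, Real.rpow_add hn0, Real.rpow_one]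
        rw [e1, e2, hh, ← hnL]
        ring

/-- Markov's inequality for the number of edges between the clusters after Phase 1. -/
theorem featureLaw_crossEdges_le {θ₁ θ₂ : ℝ} (hθ₂ : 0 < θ₂) (hgap : 0 < gap θ₁ θ₂)
    {n : ℕ} (hn : 2 ≤ n) (σ : Fin n → Bool) {K : ℝ} (hK : 0 < K) :
    featureLaw n {X | K ≤ (crossEdges (phase1 (graph θ₁ θ₂ σ X) (threshold θ₁ n)) σ).ncard} ≤
      ENNReal.ofReal (2 * θ₂ * ((n : ℝ) ^ (1 - ε θ₁ θ₂) * Real.log n) / K) := by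
  classical
  have hn2 : (2 : ℝ) ≤ n := by exact_mod_cast hn
  have hn0 : (0 : ℝ) < n := by linarith
  set l := Real.log n with hl
  have hl0 : 0 < l := Real.log_pos (by linarith)
  set L := l / n with hLdef
  have hL0 : 0 < L := div_pos hl0 hn0
  have hnL : n * L = l := by rw [hLdef]; field_simp
  have hpow : ∀ x : ℝ, (n : ℝ) ^ x = Real.exp (l * x) := fun x => Real.rpow_def_of_pos hn0 x
  have hT : (n : ℝ) * threshold θ₁ n = τ θ₁ * l := by
    rw [threshold, ← hl, ← hLdef, ← hnL]; ring
  have hτ : 2 * θ₂ < τ θ₁ := by unfold gap at hgap; linarith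
  -- The optimal Chernoff tilt: threshold over mean. It turns the exponent into exactly -ε log n.
  set e := τ θ₁ / (2 * θ₂) with he
  have he1 : 1 ≤ e := by rw [he, one_le_div (by linarith)]; exact hτ.le
  set A : Fin n × Fin n → Set (Fin n → ℝ) := fun p => {X | p.1 ≠ p.2 ∧
    ((∀ i, X i ∈ Set.Icc (0 : ℝ) 1) ∧ circDist (X p.1) (X p.2) ≤ θ₂ * L ∧
      τ θ₁ * l ≤ (nearOther σ X (θ₂ * L) p.1 p.2 : ℝ))} with hA
  have hAle : ∀ p, featureLaw n (A p) ≤ ENNReal.ofReal ((n : ℝ) ^ (-ε θ₁ θ₂) * (2 * (θ₂ * L))) := by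
    rintro ⟨u, v⟩
    by_cases huv : u ≠ v
    swap
    · have : A (u, v) = ∅ := Set.eq_empty_of_forall_notMem fun X hX => huv hX.1
      rw [this, measure_empty]
      exact zero_le
    have hB := featureLaw_dense_pair_le σ huv (r := θ₂ * L) (e := e) (T := τ θ₁ * l)
      (by positivity) he1
    refine (measure_mono fun X hX => hX.2).trans ((le_ofReal_of_mul_le
      (Real.rpow_pos_of_pos (by linarith) _) (by positivity) hB).trans (le_of_eq ?_))
    congr 1
    rw [mul_div_right_comm, Real.rpow_def_of_pos (by linarith), ← Real.exp_sub, hpow]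
    congr 2
    have h1 : (e - 1) * (2 * (θ₂ * L)) * n = (τ θ₁ - 2 * θ₂) * l := by
      rw [he, ← hnL]; field_simp
    rw [h1, ε, ← he]
    ring
  -- A measurable majorant of the number of cross edges; measurable hulls spare any measurability of
  -- the events.
  set f : (Fin n → ℝ) → ENNReal := fun X => ∑ p, (toMeasurable (featureLaw n) (A p)).indicator 1 X
    with hf
  have hfm : Measurable f :=
    Finset.measurable_sum _ fun p _ => measurable_one.indicator (measurableSet_toMeasurable _ _)
  have hfint : ∫⁻ X, f X ∂featureLaw n ≤
      ENNReal.ofReal (2 * θ₂ * ((n : ℝ) ^ (1 - ε θ₁ θ₂) * l)) := by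
    rw [hf, lintegral_finsetSum _ fun p _ =>
      measurable_one.indicator (measurableSet_toMeasurable _ _)]
    calc _ ≤ ∑ _p : Fin n × Fin n,
          ENNReal.ofReal ((n : ℝ) ^ (-ε θ₁ θ₂) * (2 * (θ₂ * L))) := by
          refine Finset.sum_le_sum fun p _ => ?_
          rw [lintegral_indicator_one (measurableSet_toMeasurable _ _), measure_toMeasurable]
          exact hAle p
      _ = _ := by
          rw [Finset.sum_const, Finset.card_univ, Fintype.card_prod, Fintype.card_fin, nsmul_eq_mul,
            ← ENNReal.ofReal_natCast, ← ENNReal.ofReal_mul (by positivity)]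
          congr 1
          rw [Nat.cast_mul, sub_eq_add_neg, Real.rpow_add hn0, Real.rpow_one, ← hnL]
          ring
  have hsub : {X | K ≤ (crossEdges (phase1 (graph θ₁ θ₂ σ X) (threshold θ₁ n)) σ).ncard} ⊆
      {X | ¬ ∀ i, X i ∈ Set.Icc (0 : ℝ) 1} ∪ {X | ENNReal.ofReal K ≤ f X} := by
    intro X hX
    by_cases hcube : ∀ i, X i ∈ Set.Icc (0 : ℝ) 1
    swap
    · exact Or.inl hcube
    right
    have hX' : K ≤ (crossEdges (phase1 (graph θ₁ θ₂ σ X) (threshold θ₁ n)) σ).ncard := hX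
    have hcount : ((crossEdges (phase1 (graph θ₁ θ₂ σ X) (threshold θ₁ n)) σ).ncard : ENNReal) ≤
        f X := by
      rw [Set.ncard_eq_toFinset_card', Finset.card_eq_sum_ones, Nat.cast_sum]
      rw [hf]
      refine le_trans (Finset.sum_le_sum fun p hp => ?_)
        (Finset.sum_le_sum_of_subset (Finset.subset_univ _))
      rw [Set.mem_toFinset] at hp
      obtain ⟨hs, hadj, hcnt⟩ := hp
      rw [Set.indicator_of_mem]
      · simp
      refine subset_toMeasurable _ _ ⟨hadj.1, hcube, ?_, ?_⟩
      · have := hadj.2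
        rwa [if_neg hs] at this
      · rw [Nat.card_fin, hT, not_le] at hcnt
        exact hcnt.le.trans (Nat.cast_le.2 (triangleCount_le_nearOther θ₁ θ₂ σ X hs))
    show ENNReal.ofReal K ≤ f X
    refine le_trans ?_ hcount
    rw [← ENNReal.ofReal_natCast]
    exact ENNReal.ofReal_le_ofReal hX'
  calc _ ≤ _ := measure_mono hsub
    _ ≤ 0 + featureLaw n {X | ENNReal.ofReal K ≤ f X} :=
        (measure_union_le _ _).trans (add_le_add_left (featureLaw_compl_cube n).le _)
    _ ≤ _ := by
        rw [zero_add, ENNReal.ofReal_div_of_pos hK]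
        refine (meas_ge_le_lintegral_div hfm.aemeasurable (by simpa using hK)
          ENNReal.ofReal_ne_top).trans ?_
        gcongr

end Bounds

/-! ### From good features to success with high probability -/

section Recovery

theorem one_sub_le_measure_of_compl_subset {Ω : Type*} [MeasurableSpace Ω] (μ : Measure Ω)
    [IsProbabilityMeasure μ] {S A : Set Ω} (h : Aᶜ ⊆ S) : 1 - μ A ≤ μ S := by
  rw [tsub_le_iff_right, ← measure_univ (μ := μ)]
  refine le_trans (measure_mono fun x _ => ?_) (measure_union_le S A)
  by_cases hx : x ∈ A
  · exact Or.inr hx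
  · exact Or.inl (h hx)

/-- Replacing `A` by its measurable hull yields a measurable minorant of `F`, so neither `A` nor `F`
has to be measurable. -/
theorem mul_one_sub_le_lintegral {Ω : Type*} [MeasurableSpace Ω] (μ : Measure Ω)
    [IsProbabilityMeasure μ] {A : Set Ω} {F : Ω → ENNReal} {c : ENNReal}
    (h : ∀ x, x ∉ A → c ≤ F x) : c * (1 - μ A) ≤ ∫⁻ x, F x ∂μ := by
  have hm := measurableSet_toMeasurable μ A
  calc c * (1 - μ A) = ∫⁻ x, (toMeasurable μ A)ᶜ.indicator (fun _ => c) x ∂μ := by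
        rw [lintegral_indicator_const hm.compl, prob_compl_eq_one_sub hm, measure_toMeasurable]
    _ ≤ _ := by
        refine lintegral_mono fun x => ?_
        by_cases hx : x ∈ toMeasurable μ A
        · rw [Set.indicator_of_notMem (by simpa using hx)]
          exact zero_le
        · rw [Set.indicator_of_mem (by simpa using hx)]
          exact h x fun h' => hx (subset_toMeasurable μ A h')

theorem recoveryProb_le_one (n : ℕ) (θ₁ θ₂ : ℝ) (σ : Fin n → Bool) (M : MSSP (Fin n))
    (Q : ℕ → Prop) : recoveryProb n θ₁ θ₂ σ M Q ≤ 1 := by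
  calc _ ≤ ∫⁻ _X, 1 ∂featureLaw n := lintegral_mono fun X => PMF.toOuterMeasure_le_one _ _
    _ = 1 := by simp

theorem one_sub_toOuterMeasure_compl_le {α : Type*} (p : PMF α) (s : Set α) :
    1 - p.toOuterMeasure sᶜ ≤ p.toOuterMeasure s := by
  rw [tsub_le_iff_right]
  calc (1 : ENNReal) = p.toOuterMeasure Set.univ := by
        rw [PMF.toOuterMeasure_apply, Set.indicator_univ, p.tsum_coe]
    _ ≤ _ := by
        rw [← Set.union_compl_self s]
        exact measure_union_le _ _

theorem natClog_two_le {n : ℕ} (hn : 2 ≤ n) : (Nat.clog 2 n : ℝ) ≤ 2 * Real.log n + 1 := by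
  have h := Nat.pow_pred_clog_lt_self (b := 2) (by norm_num) (show 1 < n by omega)
  have h1 : ((2 : ℝ) ^ (Nat.clog 2 n).pred) < n := by exact_mod_cast h
  have h2 := Real.log_lt_log (by positivity) h1
  rw [Real.log_pow] at h2
  have h3 : 0 < Nat.clog 2 n := Nat.clog_pos (by norm_num) hn
  have h4 : ((Nat.clog 2 n).pred : ℝ) = Nat.clog 2 n - 1 := by
    rw [Nat.pred_eq_sub_one, Nat.cast_sub (by omega)]; simp
  rw [h4] at h2
  have h5 := Real.log_two_gt_d9
  have h6 : (0 : ℝ) ≤ Nat.clog 2 n - 1 := by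
    have : (1 : ℝ) ≤ Nat.clog 2 n := by exact_mod_cast h3
    linarith
  nlinarith

/-- The features for which Phase 1 disconnects a cluster or leaves at least `K` ordered edges between the
clusters. -/
def phase1Bad (n : ℕ) (θ₁ θ₂ : ℝ) (σ : Fin n → Bool) (K : ℝ) : Set (Fin n → ℝ) :=
  {X | ¬ ClusterConnected (phase1 (graph θ₁ θ₂ σ X) (threshold θ₁ n)) σ} ∪
    {X | K ≤ (crossEdges (phase1 (graph θ₁ θ₂ σ X) (threshold θ₁ n)) σ).ncard}

theorem tendsto_two_mul_natCast_atTop :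
    Tendsto (fun m : ℕ => ((2 * m : ℕ) : ℝ)) atTop atTop :=
  tendsto_natCast_atTop_atTop.comp (tendsto_id.const_mul_atTop' (by norm_num))

/-- The level `K` is free so that both regimes use the same bound: `K = 1` forbids cross edges, a
growing `K` allows a few. -/
theorem tendsto_phase1Bad {θ₁ θ₂ : ℝ} (hθ₂ : 0 < θ₂) (hθ₁ : 2 ≤ θ₁) (hgap : 0 < gap θ₁ θ₂)
    (K : ℝ → ℝ) (hK : ∀ n, 1 < n → 0 < K n)
    (hlim : Tendsto (fun n : ℝ => 2 * θ₂ * (n ^ (1 - ε θ₁ θ₂) * Real.log n) / K n) atTop (𝓝 0))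
    (σ : ∀ m : ℕ, Fin (2 * m) → Bool) (hσ : ∀ m, Balanced (σ m)) :
    Tendsto (fun m => featureLaw (2 * m) (phase1Bad (2 * m) θ₁ θ₂ (σ m) (K ((2 * m : ℕ) : ℝ))))
      atTop (𝓝 0) := by
  have hτ : 0 < τ θ₁ := by unfold gap at hgap; linarith
  obtain ⟨ρ, c, κ, hρ0, hρ1, hc, hcθ, hκ, hrate⟩ := exists_rates hθ₁ hτ
  have hL : Tendsto (fun n : ℝ => θ₁ * (Real.log n / n)) atTop (𝓝 0) := by
    have := (Real.isLittleO_log_id_atTop.tendsto_div_nhds_zero).const_mul θ₁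
    simpa using this
  have hLev := tendsto_two_mul_natCast_atTop.eventually
    (hL.eventually (eventually_le_nhds (show (0 : ℝ) < 1 / 2 by norm_num)))
  have hb := (ENNReal.tendsto_ofReal ((tendsto_disconnectBound (θ₁ := θ₁) hc hκ).comp
    tendsto_two_mul_natCast_atTop)).add
    (ENNReal.tendsto_ofReal (hlim.comp tendsto_two_mul_natCast_atTop))
  rw [ENNReal.ofReal_zero, add_zero] at hb
  refine tendsto_of_tendsto_of_tendsto_of_le_of_le' tendsto_const_nhds hb
    (Eventually.of_forall fun _ => zero_le) ?_
  filter_upwards [hLev, eventually_ge_atTop 2] with m hm hm2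
  refine (measure_union_le _ _).trans (add_le_add
    (featureLaw_disconnected_le hρ0 hρ1 hc hcθ hrate hm2 hm (hσ m))
    (featureLaw_crossEdges_le hθ₂ hgap (by omega) (σ m) (hK _ ?_)))
  have : 1 < 2 * m := by omega
  exact_mod_cast this

theorem tendsto_one_sub_of_tendsto_zero {f : ℕ → ENNReal} (h : Tendsto f atTop (𝓝 0)) :
    Tendsto (fun m => 1 - f m) atTop (𝓝 1) := by
  have := ENNReal.Tendsto.sub (tendsto_const_nhds (x := (1 : ENNReal))) h (Or.inl (by simp))
  simpa using this

theorem tendsto_recovery_of_tendsto_phase1Bad {θ₁ θ₂ : ℝ} (σ : ∀ m : ℕ, Fin (2 * m) → Bool)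
    (hσ : ∀ m, Balanced (σ m))
    (h : Tendsto (fun m => featureLaw (2 * m) (phase1Bad (2 * m) θ₁ θ₂ (σ m) 1)) atTop (𝓝 0))
    (M : ∀ m : ℕ, MSSP (Fin (2 * m))) :
    Tendsto (fun m => phase1RecoveryProb (2 * m) θ₁ θ₂ (σ m)) atTop (𝓝 1) ∧
      Tendsto (fun m => recoveryProb (2 * m) θ₁ θ₂ (σ m) (M m) fun q => q = 0) atTop (𝓝 1) := by
  have h1 := tendsto_one_sub_of_tendsto_zero h
  have hgood : ∀ m X, X ∉ phase1Bad (2 * m) θ₁ θ₂ (σ m) 1 →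
      ClusterConnected (phase1 (graph θ₁ θ₂ (σ m) X) (threshold θ₁ (2 * m))) (σ m) ∧
      crossEdges (phase1 (graph θ₁ θ₂ (σ m) X) (threshold θ₁ (2 * m))) (σ m) = ∅ := by
    intro m X hX
    simp only [phase1Bad, Set.mem_union, Set.mem_ofPred_eq, not_or, not_not, not_le] at hX
    refine ⟨hX.1, ?_⟩
    have : (crossEdges (phase1 (graph θ₁ θ₂ (σ m) X) (threshold θ₁ (2 * m))) (σ m)).ncard < 1 := by
      exact_mod_cast hX.2
    rw [Nat.lt_one_iff, Set.ncard_eq_zero (Set.toFinite _)] at this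
    exact this
  constructor
  · refine tendsto_of_tendsto_of_tendsto_of_le_of_le h1 tendsto_const_nhds
      (fun m => ?_) fun m => prob_le_one
    refine one_sub_le_measure_of_compl_subset _ fun X hX => ?_
    obtain ⟨hc, h0⟩ := hgood m X hX
    exact reachableSetoid_eq_ker (reachable_iff_of_crossEdges_eq_empty hc h0)
  · refine tendsto_of_tendsto_of_tendsto_of_le_of_le' h1 tendsto_const_nhds ?_
      (Eventually.of_forall fun m => recoveryProb_le_one _ _ _ _ _ _)
    filter_upwards [eventually_ge_atTop 1] with m hm
    rw [← one_mul (1 - _)]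
    refine mul_one_sub_le_lintegral _ fun X hX => ?_
    obtain ⟨hc, h0⟩ := hgood m X hX
    rw [motifS2, s2_of_crossEdges_eq_empty (M m) ((hσ m).surjective hm) _ hc h0]
    refine le_trans ?_ (one_sub_toOuterMeasure_compl_le _ _)
    rw [(PMF.toOuterMeasure_apply_eq_zero_iff _ _).2, tsub_zero]
    rw [Set.disjoint_left]
    intro r hr hr'
    simp only [PMF.support_pure, Set.mem_singleton_iff] at hr
    subst hr
    exact hr' ⟨rfl, rfl⟩

/-- For n ≥ 4 the logarithm is at least 1, so ⌈log₂ n⌉ + 1 ≤ 4 log n, and the remaining terms are at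
most 3 log n + 3 ≤ 6 log n. -/
theorem query_budget_le {n : ℕ} (hn : 4 ≤ n) {E : ℕ} {P : ℝ}
    (hE : (E : ℝ) ≤ P * Real.log n ^ 2) :
    ((E * (Nat.clog 2 n + 1) + Nat.clog 2 n + ⌈Real.log n⌉₊ + 1 : ℕ) : ℝ) ≤
      6 * (P * Real.log n ^ 3 + Real.log n) := by
  have hn4 : (4 : ℝ) ≤ n := by exact_mod_cast hn
  have hl : 1 ≤ Real.log n := by
    rw [Real.le_log_iff_exp_le (by linarith)]
    linarith [Real.exp_one_lt_d9]
  have hc := natClog_two_le (show 2 ≤ n by omega)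
  have hceil := (Nat.ceil_lt_add_one (show 0 ≤ Real.log n by linarith)).le
  push_cast
  have h1 : (E : ℝ) * (Nat.clog 2 n + 1) ≤ (P * Real.log n ^ 2) * (4 * Real.log n) := by
    refine mul_le_mul hE (by linarith) (by positivity) ((Nat.cast_nonneg E).trans hE)
  have h2 : 0 ≤ P * Real.log n ^ 3 := by
    have h0 : 0 ≤ P * Real.log n ^ 2 := (Nat.cast_nonneg E).trans hE
    nlinarith
  nlinarith

/-- Granting ⌈log n⌉ random queries makes the conditional failure probability at most 2^{-⌈log n⌉},
at a cost absorbed by the term log n. -/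
theorem tendsto_recovery_queries {θ₁ θ₂ : ℝ} (σ : ∀ m : ℕ, Fin (2 * m) → Bool)
    (hσ : ∀ m, Balanced (σ m)) (M : ∀ m : ℕ, MSSP (Fin (2 * m)))
    (h : Tendsto (fun m => featureLaw (2 * m) (phase1Bad (2 * m) θ₁ θ₂ (σ m)
      (((2 * m : ℕ) : ℝ) ^ (1 - ε θ₁ θ₂) * Real.log ((2 * m : ℕ) : ℝ) ^ 2))) atTop (𝓝 0)) :
    Tendsto (fun m => recoveryProb (2 * m) θ₁ θ₂ (σ m) (M m) fun q =>
        (q : ℝ) ≤ 6 * (((2 * m : ℕ) : ℝ) ^ (1 - ε θ₁ θ₂) *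
          Real.log ((2 * m : ℕ) : ℝ) ^ 3 + Real.log ((2 * m : ℕ) : ℝ)))
      atTop (𝓝 1) := by
  have h1 := tendsto_one_sub_of_tendsto_zero h
  have hj : Tendsto (fun m : ℕ => ⌈Real.log ((2 * m : ℕ) : ℝ)⌉₊) atTop atTop :=
    tendsto_nat_ceil_atTop.comp (Real.tendsto_log_atTop.comp tendsto_two_mul_natCast_atTop)
  have hδ : Tendsto (fun m : ℕ => (2⁻¹ : ENNReal) ^ ⌈Real.log ((2 * m : ℕ) : ℝ)⌉₊) atTop (𝓝 0) :=
    (ENNReal.tendsto_pow_atTop_nhds_zero_of_lt_one (by simp)).comp hj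
  have h2 := ENNReal.Tendsto.mul (tendsto_one_sub_of_tendsto_zero hδ) (Or.inl one_ne_zero) h1
    (Or.inl one_ne_zero)
  rw [one_mul] at h2
  refine tendsto_of_tendsto_of_tendsto_of_le_of_le' h2 tendsto_const_nhds ?_
    (Eventually.of_forall fun m => recoveryProb_le_one _ _ _ _ _ _)
  filter_upwards [eventually_ge_atTop 2] with m hm
  refine mul_one_sub_le_lintegral _ fun X hX => ?_
  simp only [phase1Bad, Set.mem_union, Set.mem_ofPred_eq, not_or, not_not, not_le] at hX
  obtain ⟨hc, hE⟩ := hX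
  refine le_trans (tsub_le_tsub_left ?_ 1) (one_sub_toOuterMeasure_compl_le _ _)
  have hs := s2_failure_le (M m) ((hσ m).surjective (by omega))
    (fun b => by rw [(hσ m).ncard_eq, Fintype.card_fin]) _ hc _
    ⌈Real.log ((2 * m : ℕ) : ℝ)⌉₊ le_rfl
  refine le_trans ((PMF.toOuterMeasure _).mono ?_) hs
  intro r hr hr'
  refine hr ⟨hr'.1, ?_⟩
  have hb := query_budget_le (show 4 ≤ 2 * m by omega) hE.le
  refine le_trans ?_ hb
  have := hr'.2
  rw [Fintype.card_fin] at this
  exact Nat.cast_le.2 this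

end Recovery

end GBM

end

theorem theorem2 (θ₁ θ₂ : ℝ) (hθ₂ : 0 < θ₂) (hθ₂_le : 2 * θ₂ ≤ 2) (hθ₁ : 2 ≤ θ₁) :
    -- above `t₁`: Phase 1 alone recovers the clusters, and no query is made
    (GBM.t₁ θ₂ < GBM.gap θ₁ θ₂ →
      ∀ (σ : ∀ m : ℕ, Fin (2 * m) → Bool) (M : ∀ m : ℕ, GBM.MSSP (Fin (2 * m))),
        (∀ m, GBM.Balanced (σ m)) →
        Tendsto (fun m => GBM.phase1RecoveryProb (2 * m) θ₁ θ₂ (σ m)) atTop (𝓝 1) ∧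
        Tendsto (fun m => GBM.recoveryProb (2 * m) θ₁ θ₂ (σ m) (M m) fun q => q = 0)
          atTop (𝓝 1)) ∧
    -- positive gap: recovery with `O(n^{1-ε} (log n)^3 + log n)` queries, where `n = 2m`
    (0 < GBM.gap θ₁ θ₂ →
      ∃ C : ℝ, 0 < C ∧
        ∀ (σ : ∀ m : ℕ, Fin (2 * m) → Bool) (M : ∀ m : ℕ, GBM.MSSP (Fin (2 * m))),
          (∀ m, GBM.Balanced (σ m)) →
          Tendsto (fun m => GBM.recoveryProb (2 * m) θ₁ θ₂ (σ m) (M m) fun q =>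
              (q : ℝ) ≤ C * (((2 * m : ℕ) : ℝ) ^ (1 - GBM.ε θ₁ θ₂) *
                Real.log ((2 * m : ℕ) : ℝ) ^ 3 + Real.log ((2 * m : ℕ) : ℝ)))
            atTop (𝓝 1)) := by
  constructor
  · intro hgap σ M hσ
    have hgap0 := (GBM.t₁_nonneg θ₂).trans_lt hgap
    have hε := GBM.one_lt_ε hθ₂ hgap
    refine GBM.tendsto_recovery_of_tendsto_phase1Bad σ hσ
      (GBM.tendsto_phase1Bad hθ₂ hθ₁ hgap0 (fun _ => 1) (fun _ _ => one_pos) ?_ σ hσ) M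
    -- At level 1 the Markov bound is 2θ₂ n^{1-ε} log n, which vanishes because ε > 1.
    have h := (isLittleO_log_rpow_atTop (sub_pos.2 hε)).tendsto_div_nhds_zero.const_mul (2 * θ₂)
    rw [mul_zero] at h
    refine h.congr' ?_
    filter_upwards [eventually_gt_atTop 0] with n hn
    rw [div_one, ← neg_sub (GBM.ε θ₁ θ₂) 1, Real.rpow_neg hn.le, div_eq_inv_mul]
  · intro hgap
    refine ⟨6, by norm_num, fun σ M hσ => GBM.tendsto_recovery_queries σ hσ M
      (GBM.tendsto_phase1Bad hθ₂ hθ₁ hgap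
        (fun n => n ^ (1 - GBM.ε θ₁ θ₂) * Real.log n ^ 2) (fun n hn => ?_) ?_ σ hσ)⟩
    · have := Real.log_pos hn
      have := Real.rpow_pos_of_pos (show 0 < n by linarith) (1 - GBM.ε θ₁ θ₂)
      positivity
    -- The second logarithm in the level reduces the Markov bound to 2θ₂ / log n.
    · have h := Real.tendsto_log_atTop.inv_tendsto_atTop.const_mul (2 * θ₂)
      rw [mul_zero] at h
      refine h.congr' ?_
      filter_upwards [eventually_gt_atTop 1] with n hn
      have h1 := Real.log_pos hn
      have h2 := Real.rpow_pos_of_pos (show 0 < n by linarith) (1 - GBM.ε θ₁ θ₂)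
      simp only [Pi.inv_apply]
      field_simp
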